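/- **Setting.** Fix an enumeration $(l_k,\mathbf q^k)_{k\ge 1}$, without repetition, of all pairs consisting of an integer $l\ge1$ and a point of $\mathbb Q^3$. Put $a_l=3\cdot 2^{l-1}$, let $B_k$ be the closed cube with centre $\mathbf q^k$, edge $\pi/a_{l_k}$ and sides parallel to the axes, and let $\mathcal E_k:\mathbb R^3\to\mathbb R^3$ be the field with components $\tfrac13\,e^{x_j-q^k_j}/3^{\pi+|q^k_j|}$ $(j=1,2,3)$ on $B_k$, and $0$ off $B_k$. Put $F_k(f)=\int_{\mathbb R^3}\mathcal E_k\cdot f\,dx$ and $t_k=2^{-k}$. Let $\mathbf{SD}^2[\mathbb R^3]$ be the Hilbert space completion of $L^2(\mathbb R^3)^3$ for the inner product $(f,g)=\sum_k t_kF_k(f)F_k(g)$, and let $\mathbb H_{sd}$ be the closure in it of the divergence-free fields in $C_c^\infty(\mathbb R^3)^3$. Each $F_k$ extends continuously to $\mathbf{SD}^2[\mathbb R^3]$, and an element $V$ of this space is determined by the numbers $F_k(V)$; a locally integrable field $v$ is said to belong to $\mathbf{SD}^2[\mathbb R^3]$ if there is a $V\in\mathbf{SD}^2[\mathbb R^3]$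 with $F_k(V)=\int\mathcal E_k\cdot v\,dx$ for all $k$, and is then identified with $V$. Let $\nu>0$ and $0<T\le\infty$. Consider the initial value problem with zero body force $$\partial_t\mathbf u+(\mathbf u\cdot\nabla)\mathbf u-\nu\Delta\mathbf u+\nabla \pi=0,\qquad \nabla\cdot\mathbf u=0,\qquad \mathbf u(0)=\mathbf u_0\qquad\text{on }[0,T)\times\mathbb R^3 .$$ Let $X$ be $L^p(\mathbb R^3)^3$ with $1\le p\le\infty$, or a Banach space continuously embedded in $L^p(\mathbb R^3)^3$, or $\mathbf{SD}^2[\mathbb R^3]$. In each case we suppose that $\mathbf u(0)=\mathbf u_0$ almost everywhere, that $\nabla\cdot\mathbf u(t)=0$ weakly for $0\le t<T$, and that $t\mapsto\mathbf u(t)$ is continuous from $[0,T)$ to $X$; when $X=\mathbf{SD}^2[\mathbb R^3]$ we require also $\mathbf u(t)\in\mathbb H_{sd}$. * $\mathbf u$ is a *strong solution in $X$* if moreover, for every $t\in(0,T)$, the weak derivatives $\partial_j u_i(t)$ and the weak Laplacian $\Delta\mathbf u(t)$ exist as locally integrable functions, $(\mathbf u\cdot\nabla)\mathbf u(t)$ is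 locally integrable and equals $\mathbf g(t)-\nabla\pi(t)$ weakly, with a weakly divergence-free locally integrable field $\mathbf g(t)$ (its solenoidal part) and a locally integrable scalar $\pi(t)$ whose weak gradient is locally integrable, the fields $\Delta\mathbf u(t)$ and $\mathbf g(t)$ belong to $X$, and $t\mapsto \mathbf u(t)$ is continuously differentiable on $(0,T)$ in the norm of $X$ with $\partial_t\mathbf u=\nu\Delta\mathbf u-\mathbf g$ in $X$. * $\mathbf u$ is a *mild solution in $X$* if moreover, for every $t\in(0,T)$, $$\mathbf u(t)=e^{\nu t\Delta}\mathbf u_0-\int_0^te^{\nu(t-s)\Delta}\,\mathbb P\,\nabla\cdot(\mathbf u\otimes\mathbf u)(s)\,ds ,$$ where $e^{\tau\Delta}$ and $e^{\tau\Delta}\mathbb P\nabla\cdot$ ($\mathbb P$ the Leray projection) act by absolutely convergent convolution with the heat kernel and with the Oseen kernels, the first term and, for almost every $s\in(0,t)$, the integrand belong to $X$, and the integral is a convergent Bochner integral in $X$. A *solution in the sense of Kato* in $X$, where $X$ is $L^p(\mathbb R^3)^3$ or a Banach space continuously embedded in it, is a strong or a mild solution in $X$ as just defined. **Theorem 5.**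 Let $1\le p\le\infty$. If $\mathbf u$ is a solution in the sense of Kato in $L^p(\mathbb R^3)^3$, or in any Banach space $\mathcal B$ continuously embedded in $L^p(\mathbb R^3)^3$, then $\mathbf u$ is a solution in $\mathbf{SD}^2[\mathbb R^3]$ of the same problem: a strong solution in $L^p(\mathbb R^3)^3$ or in $\mathcal B$ is a strong solution in $\mathbf{SD}^2[\mathbb R^3]$, and a mild solution in $L^p(\mathbb R^3)^3$ or in $\mathcal B$ is a mild solution in $\mathbf{SD}^2[\mathbb R^3]$. -/

import Mathlib

open MeasureTheory Set Filter Topology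
open scoped ContDiff ENNReal

noncomputable section

namespace NavierStokesSD

/-- Physical space `ℝ³`, with its Euclidean norm. -/
abbrev E3 : Type := EuclideanSpace ℝ (Fin 3)

/-! ### The functions `𝓔ₖ`

The levels `l = 1, 2, …` are indexed by `l = 0, 1, …`, so that `a l = 3 · 2 ^ l`, and likewise
`k = 1, 2, …` is indexed by `k = 0, 1, …`, so that `tₖ = 2 ^ (-(k + 1))`. -/

/-- The parameter `a_l`. -/
def aPar (l : ℕ) : ℝ := 3 * 2 ^ l

/-- `ξ_l^q`, equal to `(1/n) exp (x - q) / 3 ^ (π + |q|)`, with `n = 3`, on the closed interval of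
centre `q` and half-length `3π / (4 a_l)`, and to `0` off it. -/
def xi (l : ℕ) (q : ℚ) (x : ℝ) : ℝ :=
  if |x - q| ≤ 3 * Real.pi / (4 * aPar l) then
    (1 / 3) * (Real.exp (x - q) / (3 : ℝ) ^ (Real.pi + |(q : ℝ)|))
  else 0

/-- The closed cube with centre `q` and edge `π / a_l`, sides parallel to the axes. -/
def cube (l : ℕ) (q : Fin 3 → ℚ) : Set E3 :=
  {x | ∀ j, |x j - q j| ≤ Real.pi / (2 * aPar l)}

/-- `𝓔ₖ`, for the cube that the enumeration `e` of all pairs (level, rational centre) puts in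
position `k`: the vector field `(ξ(x₁), ξ(x₂), ξ(x₃))` on the cube, `0` outside. -/
def Ecal (e : ℕ ≃ ℕ × (Fin 3 → ℚ)) (k : ℕ) : E3 → E3 :=
  (cube (e k).1 (e k).2).indicator
    fun x => WithLp.toLp 2 fun j => xi (e k).1 ((e k).2 j) (x j)

/-- `Fₖ(f) = ∫ 𝓔ₖ · f`. -/
def Ffun (e : ℕ ≃ ℕ × (Fin 3 → ℚ)) (k : ℕ) (f : E3 → E3) : ℝ :=
  ∫ x, inner ℝ (Ecal e k x) (f x)

/-- The weights `tₖ`. -/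
def tw (k : ℕ) : ℝ := (1 / 2) ^ (k + 1)

theorem tw_pos (k : ℕ) : 0 < tw k := by unfold tw; positivity

theorem summable_tw : Summable tw := by
  unfold tw
  simp_rw [pow_succ]
  exact (summable_geometric_of_lt_one (by norm_num) (by norm_num)).mul_right _

theorem aPar_ge (l : ℕ) : 3 ≤ aPar l := by
  have : (1 : ℝ) ≤ 2 ^ l := one_le_pow₀ (by norm_num)
  unfold aPar; linarith

theorem cube_half_le (l : ℕ) : Real.pi / (2 * aPar l) ≤ 1 := by
  have h := aPar_ge l
  rw [div_le_one (by linarith)]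
  linarith [Real.pi_le_four]

theorem measurable_xi (l : ℕ) (q : ℚ) : Measurable (xi l q) := by
  unfold xi
  refine Measurable.ite ?_ (by fun_prop) measurable_const
  exact measurableSet_le (by fun_prop) measurable_const

theorem measurableSet_cube (l : ℕ) (q : Fin 3 → ℚ) : MeasurableSet (cube l q) := by
  have : cube l q = ⋂ j, {x : E3 | |x j - q j| ≤ Real.pi / (2 * aPar l)} := by
    ext x; simp [cube]
  rw [this]
  exact MeasurableSet.iInter fun j => measurableSet_le (by fun_prop) measurable_const

theorem measurable_Ecal (e : ℕ ≃ ℕ × (Fin 3 → ℚ)) (k : ℕ) : Measurable (Ecal e k) := by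
  refine Measurable.indicator ?_ (measurableSet_cube _ _)
  refine (WithLp.measurable_toLp 2 _).comp (measurable_pi_lambda _ fun j => ?_)
  exact (measurable_xi _ _).comp (by fun_prop)

theorem abs_xi_le (l : ℕ) (q : ℚ) (x : ℝ) (hx : |x - q| ≤ 1) : |xi l q x| ≤ 1 := by
  unfold xi
  split_ifs
  · have h1 : Real.exp (x - q) ≤ 3 :=
      (Real.exp_le_exp.2 (le_trans (le_abs_self _) hx)).trans
        (Real.exp_one_lt_d9.le.trans (by norm_num))
    have h2 : (1 : ℝ) ≤ (3 : ℝ) ^ (Real.pi + |(q : ℝ)|) :=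
      Real.one_le_rpow (by norm_num) (by positivity)
    have h3 : Real.exp (x - q) / (3 : ℝ) ^ (Real.pi + |(q : ℝ)|) ≤ 3 :=
      (div_le_self (Real.exp_pos _).le h2).trans h1
    rw [abs_of_nonneg (by positivity)]
    linarith
  · simp

/-- The `𝓔ₖ` are bounded by one constant, on unit-size balls. -/
theorem norm_Ecal_le (e : ℕ ≃ ℕ × (Fin 3 → ℚ)) (k : ℕ) (x : E3) :
    ‖Ecal e k x‖ ≤ (Metric.closedBall
      (WithLp.toLp 2 fun j => ((e k).2 j : ℝ) : E3) 2).indicator (fun _ => (2 : ℝ)) x := by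
  by_cases hx : x ∈ cube (e k).1 (e k).2
  · have hx' : ∀ j, |x j - (e k).2 j| ≤ 1 := fun j => (hx j).trans (cube_half_le _)
    have hmem : x ∈ Metric.closedBall (WithLp.toLp 2 fun j => ((e k).2 j : ℝ) : E3) 2 := by
      rw [Metric.mem_closedBall, EuclideanSpace.dist_eq]
      refine Real.sqrt_le_iff.2 ⟨by norm_num, ?_⟩
      have : ∀ j, dist (x j) ((e k).2 j : ℝ) ^ 2 ≤ 1 := fun j => by
        rw [Real.dist_eq]; exact pow_le_one₀ (abs_nonneg _) (hx' j)
      simp only [Fin.sum_univ_three]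
      linarith [this 0, this 1, this 2]
    rw [indicator_of_mem hmem, Ecal, indicator_of_mem hx, EuclideanSpace.norm_eq]
    refine Real.sqrt_le_iff.2 ⟨by norm_num, ?_⟩
    have : ∀ j, ‖xi (e k).1 ((e k).2 j) (x j)‖ ^ 2 ≤ 1 := fun j => by
      rw [Real.norm_eq_abs]
      exact pow_le_one₀ (abs_nonneg _) (abs_xi_le _ _ _ (hx' j))
    simp only [Fin.sum_univ_three]
    linarith [this 0, this 1, this 2]
  · rw [Ecal, indicator_of_notMem hx, norm_zero]
    exact indicator_nonneg (fun _ _ => by norm_num) _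

/-- The uniform bound for the `L²` norms of the `𝓔ₖ`. -/
def EcalBound : ℝ≥0∞ := 2 * volume (Metric.closedBall (0 : E3) 2) ^ (1 / (2 : ℝ≥0∞).toReal)

theorem EcalBound_ne_top : EcalBound ≠ ⊤ :=
  ENNReal.mul_ne_top (by norm_num)
    (ENNReal.rpow_ne_top_of_nonneg (by simp) measure_closedBall_lt_top.ne)

theorem eLpNorm_Ecal_le (e : ℕ ≃ ℕ × (Fin 3 → ℚ)) (k : ℕ) :
    eLpNorm (Ecal e k) 2 volume ≤ EcalBound := by
  refine (eLpNorm_mono_real (norm_Ecal_le e k)).trans ?_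
  rw [eLpNorm_indicator_const Metric.isClosed_closedBall.measurableSet (by norm_num) (by norm_num),
    Measure.addHaar_closedBall_center, EcalBound]
  gcongr
  rw [Real.enorm_eq_ofReal (by norm_num)]
  norm_num

theorem memLp_Ecal (e : ℕ ≃ ℕ × (Fin 3 → ℚ)) (k : ℕ) : MemLp (Ecal e k) 2 volume :=
  ⟨(measurable_Ecal e k).aestronglyMeasurable,
    (eLpNorm_Ecal_le e k).trans_lt EcalBound_ne_top.lt_top⟩

theorem Ffun_eq_inner (e : ℕ ≃ ℕ × (Fin 3 → ℚ)) (k : ℕ) (f : Lp E3 2 (volume : Measure E3)) :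
    Ffun e k f = inner ℝ ((memLp_Ecal e k).toLp _) f := by
  rw [L2.inner_def, Ffun]
  refine integral_congr_ae ?_
  filter_upwards [(memLp_Ecal e k).coeFn_toLp] with x hx
  rw [hx]

theorem abs_Ffun_le (e : ℕ ≃ ℕ × (Fin 3 → ℚ)) (k : ℕ) (f : Lp E3 2 (volume : Measure E3)) :
    |Ffun e k f| ≤ EcalBound.toReal * ‖f‖ := by
  rw [Ffun_eq_inner]
  refine (abs_real_inner_le_norm _ _).trans ?_
  gcongr
  rw [Lp.norm_toLp]
  exact ENNReal.toReal_mono EcalBound_ne_top (eLpNorm_Ecal_le e k)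

theorem Ffun_add (e : ℕ ≃ ℕ × (Fin 3 → ℚ)) (k : ℕ) (f g : Lp E3 2 (volume : Measure E3)) :
    Ffun e k (f + g : Lp E3 2 (volume : Measure E3)) = Ffun e k f + Ffun e k g := by
  rw [Ffun_eq_inner, Ffun_eq_inner, Ffun_eq_inner, inner_add_right]

theorem Ffun_smul (e : ℕ ≃ ℕ × (Fin 3 → ℚ)) (k : ℕ) (r : ℝ)
    (f : Lp E3 2 (volume : Measure E3)) :
    Ffun e k (r • f : Lp E3 2 (volume : Measure E3)) = r * Ffun e k f := by
  rw [Ffun_eq_inner, Ffun_eq_inner, real_inner_smul_right]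

/-! ### The Hilbert space `SD²[ℝ³]` -/

/-- The vector space `L²[ℝ³]³`, to be given the inner product
`(f, g) = ∑ₖ tₖ Fₖ(f) Fₖ(g)` in place of the usual one. -/
def SDPre (_e : ℕ ≃ ℕ × (Fin 3 → ℚ)) : Type := Lp E3 2 (volume : Measure E3)

instance (e : ℕ ≃ ℕ × (Fin 3 → ℚ)) : AddCommGroup (SDPre e) :=
  inferInstanceAs (AddCommGroup (Lp E3 2 (volume : Measure E3)))

instance (e : ℕ ≃ ℕ × (Fin 3 → ℚ)) : Module ℝ (SDPre e) :=
  inferInstanceAs (Module ℝ (Lp E3 2 (volume : Measure E3)))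

/-- `Fₖ` as a linear functional on `L²`. -/
def FPre (e : ℕ ≃ ℕ × (Fin 3 → ℚ)) (k : ℕ) : SDPre e →ₗ[ℝ] ℝ where
  toFun f := Ffun e k (show Lp E3 2 (volume : Measure E3) from f)
  map_add' f g := Ffun_add e k f g
  map_smul' r f := Ffun_smul e k r f

theorem summable_FPre (e : ℕ ≃ ℕ × (Fin 3 → ℚ)) (f g : SDPre e) :
    Summable fun k => tw k * FPre e k f * FPre e k g := by
  set C := EcalBound.toReal * ‖(show Lp E3 2 (volume : Measure E3) from f)‖
  set D := EcalBound.toReal * ‖(show Lp E3 2 (volume : Measure E3) from g)‖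
  refine Summable.of_norm_bounded (summable_tw.mul_right (C * D)) fun k => ?_
  rw [mul_assoc, norm_mul, norm_mul, Real.norm_of_nonneg (tw_pos k).le]
  have h1 : ‖FPre e k f‖ ≤ C := abs_Ffun_le e k _
  have h2 : ‖FPre e k g‖ ≤ D := abs_Ffun_le e k _
  have := (tw_pos k).le
  gcongr

/-- The inner product `(f, g) = ∑ₖ tₖ Fₖ(f) Fₖ(g)`. -/
@[reducible] def sdCore (e : ℕ ≃ ℕ × (Fin 3 → ℚ)) : PreInnerProductSpace.Core ℝ (SDPre e) where
  inner f g := ∑' k, tw k * FPre e k f * FPre e k g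
  conj_inner_symm f g := by
    simp only [conj_trivial]
    exact tsum_congr fun k => by ring
  re_inner_nonneg f := by
    simp only [RCLike.re_to_real]
    exact tsum_nonneg fun k => by
      rw [mul_assoc]; exact mul_nonneg (tw_pos k).le (mul_self_nonneg _)
  add_left f g h := by
    rw [← (summable_FPre e f h).tsum_add (summable_FPre e g h)]
    exact tsum_congr fun k => by rw [map_add]; ring
  smul_left f g r := by
    simp only [conj_trivial]
    rw [← tsum_mul_left]
    exact tsum_congr fun k => by rw [map_smul, smul_eq_mul]; ring

instance (e : ℕ ≃ ℕ × (Fin 3 → ℚ)) : SeminormedAddCommGroup (SDPre e) :=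
  @InnerProductSpace.Core.toSeminormedAddCommGroup ℝ _ _ _ _ (sdCore e)

instance (e : ℕ ≃ ℕ × (Fin 3 → ℚ)) : InnerProductSpace ℝ (SDPre e) :=
  InnerProductSpace.ofCore (sdCore e)

theorem inner_SDPre (e : ℕ ≃ ℕ × (Fin 3 → ℚ)) (f g : SDPre e) :
    inner ℝ f g = ∑' k, tw k * FPre e k f * FPre e k g := rfl

/-- The strong distribution Hilbert space `SD²[ℝ³]`: the completion of `L²[ℝ³]³` for the inner
product `∑ₖ tₖ Fₖ(f) Fₖ(g)`. -/
abbrev SD2 (e : ℕ ≃ ℕ × (Fin 3 → ℚ)) : Type := UniformSpace.Completion (SDPre e)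

/-- The canonical map `L²[ℝ³]³ → SD²[ℝ³]`. -/
def ofL2 (e : ℕ ≃ ℕ × (Fin 3 → ℚ)) (f : Lp E3 2 (volume : Measure E3)) : SD2 e :=
  ((show SDPre e from f : SDPre e) : UniformSpace.Completion (SDPre e))

theorem abs_FPre_le (e : ℕ ≃ ℕ × (Fin 3 → ℚ)) (k : ℕ) (f : SDPre e) :
    ‖FPre e k f‖ ≤ √((tw k)⁻¹) * ‖f‖ := by
  have h : tw k * FPre e k f ^ 2 ≤ ‖f‖ ^ 2 := by
    rw [← real_inner_self_eq_norm_sq, inner_SDPre]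
    have := (summable_FPre e f f).le_tsum k fun j _ => by
      rw [mul_assoc]; exact mul_nonneg (tw_pos j).le (mul_self_nonneg _)
    calc _ = tw k * FPre e k f * FPre e k f := by ring
      _ ≤ _ := this
  rw [Real.norm_eq_abs]
  refine abs_le_of_sq_le_sq ?_ (by positivity)
  rw [mul_pow, Real.sq_sqrt (inv_nonneg.2 (tw_pos k).le), ← div_eq_inv_mul,
    le_div_iff₀ (tw_pos k)]
  linarith

/-- `Fₖ` as a continuous functional on `L²` with the `SD²` norm. -/
def FPreL (e : ℕ ≃ ℕ × (Fin 3 → ℚ)) (k : ℕ) : SDPre e →L[ℝ] ℝ :=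
  (FPre e k).mkContinuous (√((tw k)⁻¹)) (abs_FPre_le e k)

/-- The continuous extension of `Fₖ` to `SD²[ℝ³]`. -/
def FSD (e : ℕ ≃ ℕ × (Fin 3 → ℚ)) (k : ℕ) : SD2 e →L[ℝ] ℝ :=
  (FPreL e k).extend (UniformSpace.Completion.toComplL : SDPre e →L[ℝ] SD2 e)

/-- The extension does extend. -/
theorem FSD_ofL2 (e : ℕ ≃ ℕ × (Fin 3 → ℚ)) (k : ℕ) (f : Lp E3 2 (volume : Measure E3)) :
    FSD e k (ofL2 e f) = Ffun e k f :=
  (FPreL e k).extend_eq (e := (UniformSpace.Completion.toComplL : SDPre e →L[ℝ] SD2 e))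
    UniformSpace.Completion.denseRange_coe
    (UniformSpace.Completion.isUniformInducing_coe _) (show SDPre e from f)

/-- The vector field `v` belongs to `SD²[ℝ³]`, as the element `V`. An element of `SD²` is determined
by its coordinates, since `‖V‖² = ∑ₖ tₖ Fₖ(V)²`. -/
def RepresentsSD (e : ℕ ≃ ℕ × (Fin 3 → ℚ)) (v : E3 → E3) (V : SD2 e) : Prop :=
  LocallyIntegrable v ∧ ∀ k, FSD e k V = Ffun e k v

/-! ### Weak derivatives -/

/-- The partial derivative `∂ⱼ`. -/
def pd (j : Fin 3) (φ : E3 → ℝ) (x : E3) : ℝ := fderiv ℝ φ x (EuclideanSpace.single j 1)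

/-- Real test functions: `C_c^∞(ℝ³)`. -/
def IsTest (φ : E3 → ℝ) : Prop := ContDiff ℝ ∞ φ ∧ HasCompactSupport φ

/-- `∂ⱼ f = g` in the weak sense. -/
def IsWeakPartial (j : Fin 3) (f g : E3 → ℝ) : Prop :=
  LocallyIntegrable f ∧ LocallyIntegrable g ∧
    ∀ φ, IsTest φ → ∫ x, f x * pd j φ x = -∫ x, g x * φ x

/-- `div v = 0` in the weak sense. -/
def IsWeaklyDivFree (v : E3 → E3) : Prop :=
  LocallyIntegrable v ∧ ∀ φ, IsTest φ → ∫ x, ∑ j, v x j * pd j φ x = 0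

/-- `∂ⱼ vᵢ = D i j` in the weak sense, for all `i` and `j`. -/
def IsWeakJacobian (v : E3 → E3) (D : Fin 3 → Fin 3 → E3 → ℝ) : Prop :=
  ∀ i j, IsWeakPartial j (fun x => v x i) (D i j)

/-- `Δ v = w` in the weak sense. -/
def IsWeakLaplacian (v w : E3 → E3) : Prop :=
  LocallyIntegrable v ∧ LocallyIntegrable w ∧
    ∀ φ, IsTest φ → ∀ i, ∫ x, v x i * ∑ j, pd j (pd j φ) x = ∫ x, w x i * φ x

/-- `(v · ∇) v`, where `D i j = ∂ⱼ vᵢ`. -/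
def convect (v : E3 → E3) (D : Fin 3 → Fin 3 → E3 → ℝ) : E3 → E3 :=
  fun x => WithLp.toLp 2 fun i => ∑ j, v x j * D i j x

/-- `div g = 0`, and `h = g + ∇π` for a scalar `π` (for `h = (u·∇)u`,
this `π` is minus the pressure). For `h` and `g` in `L^p`, `1 < p < ∞`, this says that `g` is the Leray projection `ℙ h`. -/
def IsSolenoidalPart (h g : E3 → E3) : Prop :=
  LocallyIntegrable h ∧ IsWeaklyDivFree g ∧
    ∃ π : E3 → ℝ, ∀ j, IsWeakPartial j π (fun x => h x j - g x j)

/-! ### The heat and Oseen kernels -/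

/-- The heat kernel of `∂_t - Δ`. -/
def heatKernel (τ : ℝ) (x : E3) : ℝ :=
  (4 * Real.pi * τ) ^ (-(3 / 2) : ℝ) * Real.exp (-‖x‖ ^ 2 / (4 * τ))

/-- `w = e^{τΔ} v`. -/
def IsHeatFlow (τ : ℝ) (v w : E3 → E3) : Prop :=
  ∀ᵐ x, Integrable (fun y => heatKernel τ (x - y) • v y) ∧
    w x = ∫ y, heatKernel τ (x - y) • v y

/-- The convolution kernel of `(e^{τΔ} ℙ ∂_l)_{jk}`, `ℙ` the Leray projection, whose symbol is
`δ_{jk} - ξ_j ξ_k / |ξ|²`. It uses `(-Δ)⁻¹ e^{τΔ} = ∫_τ^∞ e^{sΔ} ds`. -/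
def oseenKernel (τ : ℝ) (j k l : Fin 3) (x : E3) : ℝ :=
  (if j = k then pd l (heatKernel τ) x else 0) +
    ∫ s in Ioi τ, pd j (pd k (pd l (heatKernel s))) x

/-- `w = e^{τΔ} ℙ div (v ⊗ v)`. -/
def IsOseenTerm (τ : ℝ) (v w : E3 → E3) : Prop :=
  ∀ᵐ x, (∀ j k l, Integrable fun y => oseenKernel τ j k l (x - y) * (v y k * v y l)) ∧
    ∀ j, w x j = ∑ k, ∑ l, ∫ y, oseenKernel τ j k l (x - y) * (v y k * v y l)

/-! ### Solutions with values in a space of vector fields -/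

/-- How a normed space `X` is a space of vector fields: which field is which element, and which
elements make up its solenoidal part. -/
structure FieldSpace (X : Type*) where
  IsField : (E3 → E3) → X → Prop
  solenoidal : Set X

/-- A space `X` embedded in `L^p[ℝ³]³` by `ι`; in particular `L^p[ℝ³]³` itself. -/
def lpFields {X : Type*} [NormedAddCommGroup X] [NormedSpace ℝ X] {p : ℝ≥0∞} [Fact (1 ≤ p)]
    (ι : X →L[ℝ] Lp E3 p (volume : Measure E3)) : FieldSpace X where
  IsField v V := v =ᵐ[volume] ι V
  solenoidal := {V | IsWeaklyDivFree (ι V)}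

/-- `ℍ_sd`: the closure in `SD²` of the divergence-free fields in `C_c^∞`. -/
def Hsd (e : ℕ ≃ ℕ × (Fin 3 → ℚ)) : Set (SD2 e) :=
  closure {V | ∃ φ : E3 → E3, ContDiff ℝ ∞ φ ∧ HasCompactSupport φ ∧
    (∀ x, ∑ j, pd j (fun y => φ y j) x = 0) ∧
    ∃ f : Lp E3 2 (volume : Measure E3), f =ᵐ[volume] φ ∧ V = ofL2 e f}

/-- The space `SD²[ℝ³]`. -/
def sdFields (e : ℕ ≃ ℕ × (Fin 3 → ℚ)) : FieldSpace (SD2 e) where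
  IsField := RepresentsSD e
  solenoidal := Hsd e

/-- The time interval `[0, T)`, for a finite or infinite `T`. -/
def timeCo (T : EReal) : Set ℝ := {t | 0 ≤ t ∧ (t : EReal) < T}

/-- The time interval `(0, T)`. -/
def timeOo (T : EReal) : Set ℝ := {t | 0 < t ∧ (t : EReal) < T}

variable {X : Type*} [NormedAddCommGroup X] [NormedSpace ℝ X]

/-- `u` is weakly divergence-free with initial value `u₀`, and is, as the curve `U`, a continuous
curve in the solenoidal part of `X`. -/
def IsFlowIn (R : FieldSpace X) (T : EReal) (u₀ : E3 → E3) (u : ℝ → E3 → E3) (U : ℝ → X) : Prop :=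
  u 0 =ᵐ[volume] u₀ ∧ ContinuousOn U (timeCo T) ∧
    ∀ t ∈ timeCo T, IsWeaklyDivFree (u t) ∧ R.IsField (u t) (U t) ∧ U t ∈ R.solenoidal

/-- Strong solutions in `X` of the initial value problem
`∂_t u + (u·∇)u - ν Δu + ∇q = 0`, that is `∂_t u = ν Δu - ℙ (u·∇)u`, with `div u = 0` and
`u(0) = u₀`, on `[0, T)`: the curve `u` lies in
`C([0,T); X) ∩ C¹((0,T); X)`, for each `t ∈ (0, T)` the fields `Δu(t)` and `ℙ (u·∇)u(t)` lie in
`X`, as `A t` and `B t`, and the derivative of `u`, in the norm of `X`, is `ν A t - B t`. -/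
def IsStrongSolution (R : FieldSpace X) (ν : ℝ) (T : EReal) (u₀ : E3 → E3) (u : ℝ → E3 → E3) :
    Prop :=
  ∃ U A B : ℝ → X, IsFlowIn R T u₀ u U ∧
    ContinuousOn (fun t => ν • A t - B t) (timeOo T) ∧
    ∀ t ∈ timeOo T,
      HasDerivAt U (ν • A t - B t) t ∧
      (∃ w, IsWeakLaplacian (u t) w ∧ R.IsField w (A t)) ∧
      ∃ D g, IsWeakJacobian (u t) D ∧ IsSolenoidalPart (convect (u t) D) g ∧ R.IsField g (B t)

/-- Mild solutions in `X` of the same problem: the curve `u` lies in `C([0,T); X)` and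
`u(t) = e^{νtΔ} u₀ - ∫₀ᵗ e^{ν(t-s)Δ} ℙ div (u ⊗ u)(s) ds` for `t ∈ (0, T)`, where the terms lie
in `X` and the integral is a convergent Bochner integral in `X`. -/
def IsMildSolution (R : FieldSpace X) (ν : ℝ) (T : EReal) (u₀ : E3 → E3) (u : ℝ → E3 → E3) :
    Prop :=
  ∃ U : ℝ → X, IsFlowIn R T u₀ u U ∧
    ∀ t ∈ timeOo T, ∃ (H : X) (N : ℝ → X),
      (∃ w, IsHeatFlow (ν * t) u₀ w ∧ R.IsField w H) ∧
      (∀ᵐ s ∂(volume.restrict (Ioo 0 t)),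
        ∃ w, IsOseenTerm (ν * (t - s)) (u s) w ∧ R.IsField w (N s)) ∧
      IntervalIntegrable N volume 0 t ∧
      U t = H - ∫ s in (0 : ℝ)..t, N s

end NavierStokesSD

end

/-!
A solution is transported from `L^p`, or from a space embedded in it, to `SD²` by one bounded linear
operator `J : L^p → SD²` that sends each field to itself. Continuity and differentiability in time
and the Bochner integral pass through `J`, and all the remaining conditions concern the fields only
(`IsFieldMap.isStrongSolution`, `IsFieldMap.isMildSolution`). Two facts carry the argument.

`L^p` is contained in `SD²` (`exists_Lp_to_SD2`). On the completion, `‖V‖² = ∑ₖ tₖ Fₖ(V)²`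
(`norm_sq_SD2`), so that bounded convergence of the coordinates is convergence in `SD²`
(`tendsto_SD2_of_coord`). The `𝓔ₖ` are bounded by a common constant on balls of a common radius,
hence a field whose `L¹` norms on unit-size balls are bounded, in particular an `L^p` field, has
bounded coordinates and is the limit in `SD²` of its truncations, which lie in `L²`.

A weakly divergence-free field `v` of this kind lies in `ℍ_sd` (`IsUnifLocIntegrable.mem_Hsd`). Its
mollifications are smooth, divergence-free and bounded, and converge to `v` in `SD²`: a mollifier
can be moved from `v` to `𝓔ₖ`, which is bounded, so that dominated convergence applies. A smooth,
bounded and divergence-free `w` is the curl of `B × x`, with `B(x) = ∫₀¹ t w(tx) dt`, by the Poincaré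
lemma. For cut-off functions `χ_R = χ(·/R)` the fields `curl (χ_R B × x) = χ_R w + ∇χ_R × (B × x)`
are test fields without divergence, and they are bounded uniformly in `R`, since `B × x` grows
linearly while `∇χ_R` is of size `1/R` on a ball of radius `2R`. They equal `w` on the ball of radius
`R`, so they converge to `w` boundedly and pointwise, hence in `SD²`. Only convergence of
coordinates is needed, which is why `p = 1` and `p = ∞` are no exceptions.
-/

noncomputable section

namespace NavierStokesSD

/-! ### Coordinates on `SD²` -/

/-- The coordinates `√tₖ Fₖ` as an isometry of `L²`, with the `SD²` norm, into `ℓ²`. -/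
def coordPre (e : ℕ ≃ ℕ × (Fin 3 → ℚ)) : SDPre e →L[ℝ] lp (fun _ : ℕ => ℝ) 2 :=
  have hsum : ∀ f : SDPre e, Summable fun k => ‖√(tw k) * FPre e k f‖ ^ 2 := fun f =>
    (summable_FPre e f f).congr fun k => by
      rw [Real.norm_eq_abs, sq_abs, mul_pow, Real.sq_sqrt (tw_pos k).le]; ring
  have hmem : ∀ f : SDPre e, Memℓp (fun k => √(tw k) * FPre e k f) 2 := fun f =>
    memℓp_gen (by simpa using hsum f)
  LinearMap.mkContinuous
    { toFun := fun f => ⟨fun k => √(tw k) * FPre e k f, hmem f⟩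
      map_add' := fun f g => by
        ext k
        simp only [map_add, mul_add]
        rfl
      map_smul' := fun r f => by ext k; simp; ring } 1 fun f => by
    rw [one_mul]
    refine abs_le_of_sq_le_sq' ?_ (norm_nonneg _) |>.2
    rw [← real_inner_self_eq_norm_sq, ← real_inner_self_eq_norm_sq, lp.inner_eq_tsum, inner_SDPre]
    refine (tsum_congr fun k => ?_).le
    simp only [LinearMap.coe_mk, AddHom.coe_mk, RCLike.inner_apply, conj_trivial]
    rw [mul_mul_mul_comm, Real.mul_self_sqrt (tw_pos k).le, mul_assoc]

theorem coordPre_apply (e : ℕ ≃ ℕ × (Fin 3 → ℚ)) (f : SDPre e) (k : ℕ) :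
    coordPre e f k = √(tw k) * FPre e k f := rfl

theorem norm_coordPre (e : ℕ ≃ ℕ × (Fin 3 → ℚ)) (f : SDPre e) : ‖coordPre e f‖ = ‖f‖ := by
  rw [← sq_eq_sq₀ (norm_nonneg _) (norm_nonneg _), ← real_inner_self_eq_norm_sq,
    ← real_inner_self_eq_norm_sq, lp.inner_eq_tsum, inner_SDPre]
  refine tsum_congr fun k => ?_
  simp only [coordPre_apply, RCLike.inner_apply, conj_trivial]
  rw [mul_mul_mul_comm, Real.mul_self_sqrt (tw_pos k).le, mul_assoc]

/-- The extension of `coordPre` to the completion `SD²`. -/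
def coord (e : ℕ ≃ ℕ × (Fin 3 → ℚ)) : SD2 e →L[ℝ] lp (fun _ : ℕ => ℝ) 2 :=
  (coordPre e).extend (UniformSpace.Completion.toComplL : SDPre e →L[ℝ] SD2 e)

theorem coord_coe (e : ℕ ≃ ℕ × (Fin 3 → ℚ)) (f : SDPre e) : coord e (f : SD2 e) = coordPre e f :=
  (coordPre e).extend_eq (e := (UniformSpace.Completion.toComplL : SDPre e →L[ℝ] SD2 e))
    UniformSpace.Completion.denseRange_coe
    (UniformSpace.Completion.isUniformInducing_coe _) f

theorem FSD_coe (e : ℕ ≃ ℕ × (Fin 3 → ℚ)) (k : ℕ) (f : SDPre e) :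
    FSD e k (f : SD2 e) = FPre e k f :=
  FSD_ofL2 e k f

theorem norm_coord (e : ℕ ≃ ℕ × (Fin 3 → ℚ)) (V : SD2 e) : ‖coord e V‖ = ‖V‖ := by
  induction V using UniformSpace.Completion.induction_on with
  | hp => exact isClosed_eq (by fun_prop) (by fun_prop)
  | ih f => rw [coord_coe, norm_coordPre, UniformSpace.Completion.norm_coe]

theorem continuous_lp_apply (k : ℕ) : Continuous fun f : lp (fun _ : ℕ => ℝ) 2 => f k := by
  refine (LipschitzWith.of_dist_le_mul (K := 1) fun f g => ?_).continuous
  rw [dist_eq_norm, dist_eq_norm, NNReal.coe_one, one_mul]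
  exact lp.norm_apply_le_norm (by norm_num) (f - g) k

theorem coord_apply (e : ℕ ≃ ℕ × (Fin 3 → ℚ)) (V : SD2 e) (k : ℕ) :
    coord e V k = √(tw k) * FSD e k V := by
  induction V using UniformSpace.Completion.induction_on with
  | hp =>
    exact isClosed_eq ((continuous_lp_apply k).comp (coord e).continuous) (by fun_prop)
  | ih f => rw [coord_coe, coordPre_apply, FSD_coe]

/-- The norm of `SD²` is `‖V‖² = ∑ₖ tₖ Fₖ(V)²` on the whole completion. -/
theorem norm_sq_SD2 (e : ℕ ≃ ℕ × (Fin 3 → ℚ)) (V : SD2 e) :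
    ‖V‖ ^ 2 = ∑' k, tw k * FSD e k V ^ 2 := by
  rw [← norm_coord, ← real_inner_self_eq_norm_sq, lp.inner_eq_tsum]
  refine tsum_congr fun k => ?_
  simp only [coord_apply, RCLike.inner_apply, conj_trivial]
  rw [mul_mul_mul_comm, Real.mul_self_sqrt (tw_pos k).le, sq]

theorem SD2_ext (e : ℕ ≃ ℕ × (Fin 3 → ℚ)) {V W : SD2 e} (h : ∀ k, FSD e k V = FSD e k W) :
    V = W := by
  rw [← sub_eq_zero, ← norm_eq_zero, ← sq_eq_zero_iff, norm_sq_SD2]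
  simp [h]

theorem norm_SD2_le (e : ℕ ≃ ℕ × (Fin 3 → ℚ)) {V : SD2 e} {C : ℝ} (hC : 0 ≤ C)
    (h : ∀ k, |FSD e k V| ≤ C) : ‖V‖ ≤ √(∑' k, tw k) * C := by
  refine abs_le_of_sq_le_sq' ?_ (by positivity) |>.2
  have hle : ∀ k, tw k * FSD e k V ^ 2 ≤ tw k * C ^ 2 := fun k =>
    mul_le_mul_of_nonneg_left (sq_le_sq' (abs_le.1 (h k)).1 (abs_le.1 (h k)).2) (tw_pos k).le
  have hs : Summable fun k => tw k * C ^ 2 := summable_tw.mul_right _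
  rw [norm_sq_SD2, mul_pow, Real.sq_sqrt (tsum_nonneg fun k => (tw_pos k).le), ← tsum_mul_right]
  exact Summable.tsum_le_tsum hle
    (hs.of_nonneg_of_le (fun k => mul_nonneg (tw_pos k).le (sq_nonneg _)) hle) hs

/-- Bounded coordinatewise convergence is convergence in `SD²`, because `∑ₖ tₖ < ∞`. -/
theorem tendsto_SD2_of_coord {ι : Type*} {l : Filter ι} (e : ℕ ≃ ℕ × (Fin 3 → ℚ))
    {V : ι → SD2 e} {W : SD2 e} {C : ℝ} (hC : ∀ᶠ n in l, ∀ k, |FSD e k (V n) - FSD e k W| ≤ C)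
    (h : ∀ k, Tendsto (fun n => FSD e k (V n)) l (𝓝 (FSD e k W))) : Tendsto V l (𝓝 W) := by
  rw [tendsto_iff_norm_sub_tendsto_zero]
  have hsq : Tendsto (fun n => ‖V n - W‖ ^ 2) l (𝓝 0) := by
    simp_rw [norm_sq_SD2, map_sub]
    rw [← tsum_zero (α := ℝ) (β := ℕ)]
    refine tendsto_tsum_of_dominated_convergence (bound := fun k => tw k * C ^ 2)
      (summable_tw.mul_right _) (fun k => ?_) ?_
    · have := (((h k).sub_const (FSD e k W)).pow 2).const_mul (tw k)
      simpa using this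
    · filter_upwards [hC] with n hn k
      rw [norm_mul, Real.norm_of_nonneg (tw_pos k).le, norm_pow, Real.norm_eq_abs]
      have := (tw_pos k).le
      gcongr
      exact hn k
  have := hsq.sqrt
  simpa [Real.sqrt_sq (norm_nonneg _)] using this

/-- A sequence in `SD²` with uniformly bounded, convergent coordinates has a limit. -/
theorem exists_SD2_of_tendsto (e : ℕ ≃ ℕ × (Fin 3 → ℚ)) {V : ℕ → SD2 e} {x : ℕ → ℝ} {C : ℝ}
    (hC : ∀ n k, |FSD e k (V n)| ≤ C)
    (h : ∀ k, Tendsto (fun n => FSD e k (V n)) atTop (𝓝 (x k))) :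
    ∃ W : SD2 e, ∀ k, FSD e k W = x k := by
  have hcau : CauchySeq V := by
    rw [cauchySeq_iff_tendsto_dist_atTop_0]
    have h0 : Tendsto (fun q : ℕ × ℕ => V q.1 - V q.2) atTop (𝓝 0) := by
      refine tendsto_SD2_of_coord (C := C + C) e (.of_forall fun q k => ?_) fun k => ?_
      · rw [map_zero, sub_zero, map_sub]
        exact (abs_sub _ _).trans (add_le_add (hC _ _) (hC _ _))
      · simp only [map_sub, map_zero]
        rw [← prod_atTop_atTop_eq, ← sub_self (x k)]
        exact ((h k).comp tendsto_fst).sub ((h k).comp tendsto_snd)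
    simpa [dist_eq_norm] using h0.norm
  obtain ⟨W, hW⟩ := cauchySeq_tendsto_of_complete hcau
  exact ⟨W, fun k => tendsto_nhds_unique (((FSD e k).continuous.tendsto W).comp hW) (h k)⟩

/-! ### Uniformly locally integrable fields -/

/-- `v` is locally integrable, with integral of `‖v‖` at most `C` over each ball of radius `3`.
The radius leaves room for the support of `𝓔ₖ`, of radius `2`, and a mollifier of radius `1`. -/
def IsUnifLocIntegrable (v : E3 → E3) (C : ℝ) : Prop :=
  LocallyIntegrable v ∧ ∀ c : E3, ∫ x in Metric.closedBall c 3, ‖v x‖ ≤ C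

/-- The centre of the cube that carries `𝓔ₖ`. -/
def centre (e : ℕ ≃ ℕ × (Fin 3 → ℚ)) (k : ℕ) : E3 := WithLp.toLp 2 fun j => ((e k).2 j : ℝ)

theorem norm_Ecal_le_centre (e : ℕ ≃ ℕ × (Fin 3 → ℚ)) (k : ℕ) (x : E3) :
    ‖Ecal e k x‖ ≤ (Metric.closedBall (centre e k) 3).indicator (fun _ => (2 : ℝ)) x :=
  (norm_Ecal_le e k x).trans
    (indicator_le_indicator_of_subset (Metric.closedBall_subset_closedBall (by norm_num))
      (fun _ => by norm_num) x)

theorem integrable_Ecal (e : ℕ ≃ ℕ × (Fin 3 → ℚ)) (k : ℕ) : Integrable (Ecal e k) :=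
  Integrable.mono' ((integrableOn_const (measure_closedBall_lt_top (x := centre e k) (r := 3)).ne
      (C := (2 : ℝ))).integrable_indicator Metric.isClosed_closedBall.measurableSet)
    (measurable_Ecal e k).aestronglyMeasurable (.of_forall (norm_Ecal_le_centre e k))

theorem integrable_indicator_norm {v : E3 → E3} (hv : LocallyIntegrable v) (c : E3) (r : ℝ) :
    Integrable ((Metric.closedBall c r).indicator fun x => 2 * ‖v x‖) :=
  IntegrableOn.integrable_indicator
    ((hv.integrableOn_isCompact (isCompact_closedBall c r)).norm.const_mul 2)
    Metric.isClosed_closedBall.measurableSet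

theorem norm_inner_le_indicator {G v : E3 → E3} {c : E3} {r : ℝ}
    (hG : ∀ x, ‖G x‖ ≤ (Metric.closedBall c r).indicator (fun _ => (2 : ℝ)) x) (x : E3) :
    ‖(inner ℝ (G x) (v x) : ℝ)‖ ≤ (Metric.closedBall c r).indicator (fun x => 2 * ‖v x‖) x := by
  refine (norm_inner_le_norm _ _).trans ?_
  have := hG x
  by_cases hx : x ∈ Metric.closedBall c r
  · rw [indicator_of_mem hx] at this ⊢
    gcongr
  · rw [indicator_of_notMem hx] at this ⊢
    rw [le_antisymm this (norm_nonneg _), zero_mul]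

theorem IsUnifLocIntegrable.abs_integral_inner_le {v G : E3 → E3} {C : ℝ} {c : E3}
    (hv : IsUnifLocIntegrable v C)
    (hG : ∀ x, ‖G x‖ ≤ (Metric.closedBall c 3).indicator (fun _ => (2 : ℝ)) x) :
    |∫ x, (inner ℝ (G x) (v x) : ℝ)| ≤ 2 * C := by
  refine (norm_integral_le_of_norm_le (integrable_indicator_norm hv.1 c 3)
    (.of_forall (norm_inner_le_indicator hG))).trans ?_
  rw [integral_indicator Metric.isClosed_closedBall.measurableSet, integral_const_mul]
  linarith [hv.2 c]

theorem IsUnifLocIntegrable.abs_Ffun_le {v : E3 → E3} {C : ℝ} (hv : IsUnifLocIntegrable v C)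
    (e : ℕ ≃ ℕ × (Fin 3 → ℚ)) (k : ℕ) : |Ffun e k v| ≤ 2 * C :=
  hv.abs_integral_inner_le (norm_Ecal_le_centre e k)

/-- A uniformly locally integrable field belongs to `SD²`: its truncations in space and size are in
`L²`, and their coordinates are bounded and converge. -/
theorem IsUnifLocIntegrable.exists_representsSD {v : E3 → E3} {C : ℝ}
    (hv : IsUnifLocIntegrable v C) (e : ℕ ≃ ℕ × (Fin 3 → ℚ)) : ∃ V, RepresentsSD e v V := by
  obtain ⟨v', hv'm, hvv'⟩ := hv.1.aestronglyMeasurable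
  set S : ℕ → Set E3 := fun n => {x | ‖x‖ ≤ n ∧ ‖v' x‖ ≤ n}
  have hS : ∀ n, MeasurableSet (S n) := fun n =>
    (measurableSet_le measurable_norm measurable_const).inter
      (measurableSet_le hv'm.measurable.norm measurable_const)
  have hle : ∀ n x, ‖(S n).indicator v' x‖ ≤ ‖v' x‖ := fun n x => norm_indicator_le_norm_self _ _
  have hmem : ∀ n, MemLp ((S n).indicator v') 2 volume := by
    intro n
    refine MemLp.of_le (g := (Metric.closedBall (0 : E3) n).indicator fun _ => (n : ℝ))
      (memLp_indicator_const 2 Metric.isClosed_closedBall.measurableSet _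
        (.inr measure_closedBall_lt_top.ne))
      (hv'm.indicator (hS n)).aestronglyMeasurable (.of_forall fun x => ?_)
    by_cases hx : x ∈ S n
    · rw [indicator_of_mem hx, indicator_of_mem (by simpa using hx.1)]
      simpa using hx.2
    · rw [indicator_of_notMem hx, norm_zero]
      exact norm_nonneg _
  have hF : ∀ n k, FSD e k (ofL2 e ((hmem n).toLp _)) =
      ∫ x, inner ℝ (Ecal e k x) ((S n).indicator v' x) := fun n k => by
    rw [FSD_ofL2]
    refine integral_congr_ae ?_
    filter_upwards [(hmem n).coeFn_toLp] with x hx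
    rw [hx]
  have hbd : ∀ n k, ∀ᵐ x, ‖(inner ℝ (Ecal e k x) ((S n).indicator v' x) : ℝ)‖ ≤
      (Metric.closedBall (centre e k) 3).indicator (fun x => 2 * ‖v x‖) x := fun n k => by
    filter_upwards [hvv'] with x hx
    refine (norm_inner_le_indicator (norm_Ecal_le_centre e k) x).trans ?_
    refine indicator_le_indicator ?_
    rw [hx]
    linarith [hle n x]
  obtain ⟨V, hV⟩ := exists_SD2_of_tendsto (V := fun n => ofL2 e ((hmem n).toLp _))
    (x := fun k => Ffun e k v) (C := 2 * C) e
    (fun n k => by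
      rw [hF]
      refine (norm_integral_le_of_norm_le (integrable_indicator_norm hv.1 _ 3) (hbd n k)).trans ?_
      rw [integral_indicator Metric.isClosed_closedBall.measurableSet, integral_const_mul]
      linarith [hv.2 (centre e k)])
    (fun k => by
      simp_rw [hF]
      refine tendsto_integral_of_dominated_convergence _ (fun n => ?_)
        (integrable_indicator_norm hv.1 (centre e k) 3) (fun n => hbd n k) ?_
      · exact (measurable_Ecal e k).aestronglyMeasurable.inner
          (hv'm.indicator (hS n)).aestronglyMeasurable
      · filter_upwards [hvv'] with x hx
        refine tendsto_const_nhds.congr' ?_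
        filter_upwards [eventually_ge_atTop ⌈‖x‖⌉₊, eventually_ge_atTop ⌈‖v' x‖⌉₊] with n h1 h2
        rw [indicator_of_mem (show x ∈ S n from ⟨Nat.ceil_le.1 h1, Nat.ceil_le.1 h2⟩), hx])
  exact ⟨V, hv.1, hV⟩

/-- The constant in Hölder's inequality for balls of radius `3`. -/
def holderConst (p : ℝ≥0∞) : ℝ :=
  (volume (Metric.closedBall (0 : E3) 3) ^ (1 - 1 / p.toReal)).toReal

theorem isUnifLocIntegrable_Lp {p : ℝ≥0∞} (hp : 1 ≤ p) (f : Lp E3 p (volume : Measure E3)) :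
    IsUnifLocIntegrable f (holderConst p * ‖f‖) := by
  refine ⟨(Lp.memLp f).locallyIntegrable hp, fun c => ?_⟩
  have hne : volume (Metric.closedBall (0 : E3) 3) ^ (1 - 1 / p.toReal) ≠ ⊤ :=
    (ENNReal.rpow_lt_top_of_nonneg (by
      rcases eq_or_ne p ⊤ with rfl | h
      · simp
      · have : 1 ≤ p.toReal := by simpa using ENNReal.toReal_mono h hp
        rw [sub_nonneg, div_le_one (by linarith)]
        exact this) measure_closedBall_lt_top.ne).ne
  rw [integral_norm_eq_lintegral_enorm (Lp.aestronglyMeasurable f).restrict,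
    ← eLpNorm_one_eq_lintegral_enorm, Lp.norm_def, mul_comm, holderConst, ← ENNReal.toReal_mul]
  refine ENNReal.toReal_mono (ENNReal.mul_ne_top (Lp.eLpNorm_ne_top f) hne) ?_
  refine (eLpNorm_le_eLpNorm_mul_rpow_measure_univ hp
    (Lp.aestronglyMeasurable f).restrict).trans ?_
  rw [Measure.restrict_apply_univ, Measure.addHaar_closedBall_center, ENNReal.toReal_one,
    div_one]
  gcongr
  exact Measure.restrict_le_self

theorem RepresentsSD.congr_ae {e : ℕ ≃ ℕ × (Fin 3 → ℚ)} {v w : E3 → E3} {V : SD2 e}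
    (h : RepresentsSD e v V) (hvw : w =ᵐ[volume] v) : RepresentsSD e w V := by
  refine ⟨h.1.congr hvw.symm, fun k => (h.2 k).trans (integral_congr_ae ?_)⟩
  filter_upwards [hvw] with x hx
  rw [hx]

theorem integrable_Ecal_inner (e : ℕ ≃ ℕ × (Fin 3 → ℚ)) (k : ℕ) {v : E3 → E3}
    (hv : LocallyIntegrable v) : Integrable fun x => (inner ℝ (Ecal e k x) (v x) : ℝ) :=
  (integrable_indicator_norm hv (centre e k) 3).mono'
    ((measurable_Ecal e k).aestronglyMeasurable.inner hv.aestronglyMeasurable)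
    (.of_forall (norm_inner_le_indicator (norm_Ecal_le_centre e k)))

/-- The inclusion of `L^p[ℝ³]³` in `SD²[ℝ³]`, as a bounded operator. -/
theorem exists_Lp_to_SD2 (e : ℕ ≃ ℕ × (Fin 3 → ℚ)) (p : ℝ≥0∞) [Fact (1 ≤ p)] :
    ∃ J : Lp E3 p (volume : Measure E3) →L[ℝ] SD2 e,
      ∀ f : Lp E3 p (volume : Measure E3), RepresentsSD e f (J f) := by
  have hp : 1 ≤ p := Fact.out
  choose J hJ using fun f : Lp E3 p (volume : Measure E3) =>
    (isUnifLocIntegrable_Lp hp f).exists_representsSD e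
  have hint : ∀ (f : Lp E3 p (volume : Measure E3)) k,
      Integrable fun x => (inner ℝ (Ecal e k x) (f x) : ℝ) := fun f k =>
    integrable_Ecal_inner e k (hJ f).1
  have hnorm : ∀ f, ‖J f‖ ≤ √(∑' k, tw k) * (2 * holderConst p) * ‖f‖ := fun f => by
    rw [mul_assoc]
    have h0 : 0 ≤ holderConst p := ENNReal.toReal_nonneg
    refine norm_SD2_le e (mul_nonneg (by positivity) (norm_nonneg f)) fun k => ?_
    rw [(hJ f).2 k, mul_assoc]
    exact (isUnifLocIntegrable_Lp hp f).abs_Ffun_le e k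
  refine ⟨LinearMap.mkContinuous
    { toFun := J
      map_add' := fun f g => SD2_ext e fun k => ?_
      map_smul' := fun r f => SD2_ext e fun k => ?_ }
    (√(∑' k, tw k) * (2 * holderConst p)) hnorm, hJ⟩
  · rw [map_add, (hJ _).2, (hJ _).2, (hJ _).2, Ffun, Ffun, Ffun,
      ← integral_add (hint f k) (hint g k)]
    refine integral_congr_ae ?_
    filter_upwards [Lp.coeFn_add f g] with x hx
    rw [hx, Pi.add_apply, inner_add_right]
  · rw [RingHom.id_apply, map_smul, (hJ _).2, (hJ _).2, Ffun, Ffun, smul_eq_mul,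
      ← integral_const_mul]
    refine integral_congr_ae ?_
    filter_upwards [Lp.coeFn_smul r f] with x hx
    rw [hx, Pi.smul_apply, real_inner_smul_right]

/-! ### Cutting off a smooth solenoidal field -/

theorem sum_apply_single_mul (L : E3 →L[ℝ] ℝ) (y : E3) :
    ∑ j, L (EuclideanSpace.single j 1) * y j = L y := by
  have hy : y = ∑ j, y j • (EuclideanSpace.single j (1 : ℝ) : E3) := by
    ext i
    simp [Finset.sum_apply, Pi.single_apply]
  conv_rhs => rw [hy]
  simp [map_sum, mul_comm]

/-- The trace of an endomorphism of `ℝ³`, in the standard basis. -/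
def trace3 (A : E3 →L[ℝ] E3) : ℝ := ∑ j, A (EuclideanSpace.single j 1) j

theorem trace3_add (A A' : E3 →L[ℝ] E3) : trace3 (A + A') = trace3 A + trace3 A' := by
  simp [trace3, Finset.sum_add_distrib]

theorem trace3_sub (A A' : E3 →L[ℝ] E3) : trace3 (A - A') = trace3 A - trace3 A' := by
  simp [trace3, Finset.sum_sub_distrib]

theorem trace3_smul (r : ℝ) (A : E3 →L[ℝ] E3) : trace3 (r • A) = r * trace3 A := by
  simp [trace3, Finset.mul_sum]

theorem trace3_smulRight (L : E3 →L[ℝ] ℝ) (y : E3) : trace3 (L.smulRight y) = L y := by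
  rw [← sum_apply_single_mul L y]
  simp [trace3]

theorem trace3_id : trace3 (ContinuousLinearMap.id ℝ E3) = 3 := by
  simp [trace3]

/-- The classical divergence, as the trace of the derivative. -/
def divergence (φ : E3 → E3) (x : E3) : ℝ := trace3 (fderiv ℝ φ x)

theorem sum_pd_eq_divergence {φ : E3 → E3} {x : E3} (h : DifferentiableAt ℝ φ x) :
    ∑ j, pd j (fun y => φ y j) x = divergence φ x := by
  rw [divergence, trace3]
  refine Finset.sum_congr rfl fun j _ => ?_
  have := ((EuclideanSpace.proj j : E3 →L[ℝ] ℝ).hasFDerivAt (x := φ x)).comp x h.hasFDerivAt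
  rw [pd, show (fun y => φ y j) = (EuclideanSpace.proj j : E3 →L[ℝ] ℝ) ∘ φ from rfl, this.fderiv]
  rfl

section RayAverage

variable {G : Type*} [NormedAddCommGroup G] [NormedSpace ℝ G]

/-- The weighted average `∫₀¹ c(t) w(tx) dt` over the segment from the origin to `x`. -/
def rayAverage (c : ℝ → ℝ) (w : E3 → G) (x : E3) : G := ∫ t in (0 : ℝ)..1, c t • w (t • x)

theorem hasFDerivAt_rayAverage {c : ℝ → ℝ} (hc : Continuous c) {w : E3 → G}
    (hw : ContDiff ℝ 1 w) (x : E3) :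
    HasFDerivAt (rayAverage c w) (rayAverage (fun t => c t * t) (fderiv ℝ w) x) x := by
  have hw' : Continuous (fderiv ℝ w) := hw.continuous_fderiv one_ne_zero
  have hwc : Continuous w := hw.continuous
  obtain ⟨M, hM⟩ := ((isCompact_Icc (a := (0 : ℝ)) (b := 1)).prod
    (isCompact_closedBall x 1)).exists_bound_of_continuousOn
    (f := fun q : ℝ × E3 => (c q.1 * q.1) • fderiv ℝ w (q.1 • q.2))
    (Continuous.continuousOn (by fun_prop))
  refine intervalIntegral.hasFDerivAt_integral_of_dominated_of_fderiv_le
    (F' := fun x t => (c t * t) • fderiv ℝ w (t • x)) (bound := fun _ => M)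
    (Metric.ball_mem_nhds x one_pos)
    (.of_forall fun y => (Continuous.aestronglyMeasurable (by fun_prop)))
    (Continuous.intervalIntegrable (by fun_prop) _ _)
    (Continuous.aestronglyMeasurable (by fun_prop))
    (.of_forall fun t ht y hy => hM (t, y) ⟨?_, Metric.ball_subset_closedBall hy⟩)
    intervalIntegrable_const (.of_forall fun t _ y _ => ?_)
  · rw [uIoc_of_le zero_le_one] at ht
    exact Ioc_subset_Icc_self ht
  · have h1 : HasFDerivAt (fun y : E3 => t • y) (t • ContinuousLinearMap.id ℝ E3) y :=
      (hasFDerivAt_id y).const_smul t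
    have h2 := ((hw.differentiable one_ne_zero (t • y)).hasFDerivAt.comp y h1).const_smul (c t)
    refine h2.congr_fderiv ?_
    rw [ContinuousLinearMap.comp_smul, ContinuousLinearMap.comp_id, smul_smul]

theorem contDiff_rayAverage {n : ℕ} : ∀ {G : Type} [NormedAddCommGroup G] [NormedSpace ℝ G]
    {c : ℝ → ℝ} (_ : Continuous c) {w : E3 → G} (_ : ContDiff ℝ (n + 1) w),
    ContDiff ℝ n (rayAverage c w) := by
  induction n with
  | zero =>
    intro G _ _ c hc w hw
    refine contDiff_zero.2 (continuous_iff_continuousAt.2 fun x => ?_)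
    exact (hasFDerivAt_rayAverage hc (hw.of_le (by simp)) x).continuousAt
  | succ n ih =>
    intro G _ _ c hc w hw
    have hd : ∀ x, HasFDerivAt (rayAverage c w) _ x :=
      hasFDerivAt_rayAverage hc (hw.of_le (by simp))
    push_cast at hw ⊢
    rw [contDiff_succ_iff_fderiv] at hw ⊢
    refine ⟨fun x => (hd x).differentiableAt, by simp, ?_⟩
    rw [show fderiv ℝ (rayAverage c w) = rayAverage (fun t => c t * t) (fderiv ℝ w) from
      funext fun x => (hd x).fderiv]
    exact ih (by fun_prop) hw.2.2

end RayAverage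

/-- `B(x) = ∫₀¹ t w(tx) dt`; `B × x` is the vector potential of a solenoidal field `w` that the
Poincaré lemma gives. -/
abbrev poincareField (w : E3 → E3) : E3 → E3 := rayAverage id w

theorem contDiff_poincareField {w : E3 → E3} (hw : ContDiff ℝ ∞ w) :
    ContDiff ℝ ∞ (poincareField w) :=
  contDiff_infty.2 fun _ => contDiff_rayAverage continuous_id (hw.of_le (by exact_mod_cast le_top))

theorem norm_poincareField_le {w : E3 → E3} {M : ℝ} (hM : ∀ x, ‖w x‖ ≤ M) (x : E3) :
    ‖poincareField w x‖ ≤ M := by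
  have := intervalIntegral.norm_integral_le_of_norm_le_const (a := 0) (b := 1) (C := M)
    (f := fun t : ℝ => id t • w (t • x)) fun t ht => by
      rw [uIoc_of_le zero_le_one] at ht
      rw [norm_smul, id, Real.norm_of_nonneg ht.1.le]
      exact (mul_le_of_le_one_left (norm_nonneg _) ht.2).trans (hM _)
  simpa [poincareField, rayAverage] using this

theorem fderiv_poincareField_apply {w : E3 → E3} (hw : ContDiff ℝ ∞ w) (x y : E3) :
    fderiv ℝ (poincareField w) x y = ∫ t in (0 : ℝ)..1, (t * t) • fderiv ℝ w (t • x) y := by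
  have hw' : Continuous (fderiv ℝ w) := hw.continuous_fderiv (by simp)
  rw [(hasFDerivAt_rayAverage continuous_id (hw.of_le (by simp)) x).fderiv, rayAverage]
  have := (ContinuousLinearMap.apply ℝ E3 y).intervalIntegral_comp_comm
    (Continuous.intervalIntegrable (μ := volume)
      (show Continuous fun t : ℝ => (t * t) • fderiv ℝ w (t • x) by fun_prop) 0 1)
  simpa using this.symm

theorem divergence_poincareField {w : E3 → E3} (hw : ContDiff ℝ ∞ w)
    (hdiv : ∀ x, divergence w x = 0) (x : E3) : divergence (poincareField w) x = 0 := by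
  have hw' : Continuous (fderiv ℝ w) := hw.continuous_fderiv (by simp)
  have hj : ∀ j : Fin 3, fderiv ℝ (poincareField w) x (EuclideanSpace.single j 1) j =
      ∫ t in (0 : ℝ)..1, (t * t) * fderiv ℝ w (t • x) (EuclideanSpace.single j 1) j := fun j => by
    rw [fderiv_poincareField_apply hw]
    have := (EuclideanSpace.proj j : E3 →L[ℝ] ℝ).intervalIntegral_comp_comm
      (Continuous.intervalIntegrable (μ := volume)
        (show Continuous fun t : ℝ => (t * t) • fderiv ℝ w (t • x) (EuclideanSpace.single j 1)
          by fun_prop) 0 1)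
    exact this.symm
  rw [divergence, trace3, Finset.sum_congr rfl fun j _ => hj j, ← intervalIntegral.integral_finsetSum
    fun j _ => Continuous.intervalIntegrable (by fun_prop) _ _]
  simp_rw [← Finset.mul_sum]
  have h0 : ∀ t : ℝ, ∑ j, fderiv ℝ w (t • x) (EuclideanSpace.single j 1) j = 0 := fun t =>
    hdiv (t • x)
  simp [h0]

/-- With `(x·∇)B + 2B = w` and `div B = 0`, the curl of `B × x` is `w`. -/
theorem fderiv_poincareField_self {w : E3 → E3} (hw : ContDiff ℝ ∞ w) (x : E3) :
    fderiv ℝ (poincareField w) x x + (2 : ℝ) • poincareField w x = w x := by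
  have hw' : Continuous (fderiv ℝ w) := hw.continuous_fderiv (by simp)
  have hwc : Continuous w := hw.continuous
  rw [fderiv_poincareField_apply hw, poincareField, rayAverage, ← intervalIntegral.integral_smul,
    ← intervalIntegral.integral_add (Continuous.intervalIntegrable (by fun_prop) _ _)
      (Continuous.intervalIntegrable (by fun_prop) _ _)]
  have hder : ∀ t : ℝ, HasDerivAt (fun t : ℝ => (t * t) • w (t • x))
      ((t * t) • fderiv ℝ w (t • x) x + (2 : ℝ) • id t • w (t • x)) t := fun t => by
    have h1 : HasDerivAt (fun t : ℝ => t • x) ((1 : ℝ) • x) t := (hasDerivAt_id t).smul_const x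
    have h2 := ((hw.differentiable (by simp) (t • x)).hasFDerivAt).comp_hasDerivAt t h1
    have h3 := ((hasDerivAt_id t).mul (hasDerivAt_id t)).smul h2
    refine h3.congr_deriv ?_
    simp only [one_smul, smul_smul, id, Function.comp]
    congr 2
    ring
  rw [intervalIntegral.integral_eq_sub_of_hasDerivAt (fun t _ => hder t)
    (Continuous.intervalIntegrable (by fun_prop) _ _)]
  simp

/-- The field `χ w + ∇χ × (B × x)`, that is `curl (χ B × x)`, with the triple product expanded. -/
def solenoidalCutoff (χ : E3 → ℝ) (w : E3 → E3) (x : E3) : E3 :=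
  χ x • w x + fderiv ℝ χ x x • poincareField w x - fderiv ℝ χ x (poincareField w x) • x

theorem contDiff_solenoidalCutoff {χ : E3 → ℝ} (hχ : ContDiff ℝ ∞ χ) {w : E3 → E3}
    (hw : ContDiff ℝ ∞ w) : ContDiff ℝ ∞ (solenoidalCutoff χ w) := by
  have hB := contDiff_poincareField hw
  have hχ' : ContDiff ℝ ∞ (fderiv ℝ χ) := hχ.fderiv_right (by simp)
  unfold solenoidalCutoff
  exact ((hχ.smul hw).add ((hχ'.clm_apply contDiff_id).smul hB)).sub
    ((hχ'.clm_apply hB).smul contDiff_id)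

theorem hasCompactSupport_solenoidalCutoff {χ : E3 → ℝ} (hχ : HasCompactSupport χ)
    (w : E3 → E3) : HasCompactSupport (solenoidalCutoff χ w) := by
  refine hχ.mono' fun x hx => ?_
  by_contra h
  have h' : x ∉ tsupport (fderiv ℝ χ) := fun h' => h (tsupport_fderiv_subset ℝ h')
  refine hx ?_
  simp [solenoidalCutoff, image_eq_zero_of_notMem_tsupport h, image_eq_zero_of_notMem_tsupport h']

theorem divergence_solenoidalCutoff {χ : E3 → ℝ} (hχ : ContDiff ℝ ∞ χ) {w : E3 → E3}
    (hw : ContDiff ℝ ∞ w) (hdiv : ∀ x, divergence w x = 0) (x : E3) :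
    divergence (solenoidalCutoff χ w) x = 0 := by
  have hB := contDiff_poincareField hw
  have hχ' : ContDiff ℝ ∞ (fderiv ℝ χ) := hχ.fderiv_right (by simp)
  set B := poincareField w
  have dχ := (hχ.differentiable (by simp) x).hasFDerivAt
  have dχ' := (hχ'.differentiable (by simp) x).hasFDerivAt
  have dB := (hB.differentiable (by simp) x).hasFDerivAt
  have dw := (hw.differentiable (by simp) x).hasFDerivAt
  have hd := ((dχ.smul dw).add ((dχ'.clm_apply (hasFDerivAt_id x)).smul dB)).sub
    ((dχ'.clm_apply dB).smul (hasFDerivAt_id x))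
  have hsymm : IsSymmSndFDerivAt ℝ χ x :=
    hχ.contDiffAt.isSymmSndFDerivAt
      (by simpa using WithTop.coe_le_coe.2 (le_top (a := (2 : ℕ∞))))
  have hfd : fderiv ℝ (solenoidalCutoff χ w) x = _ := hd.fderiv
  have hw0 : trace3 (fderiv ℝ w x) = 0 := hdiv x
  have hB0 : trace3 (fderiv ℝ B x) = 0 := divergence_poincareField hw hdiv x
  have hself : fderiv ℝ χ x (fderiv ℝ B x x) + 2 * fderiv ℝ χ x (B x) = fderiv ℝ χ x (w x) := by
    rw [← fderiv_poincareField_self hw x, map_add, map_smul, smul_eq_mul]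
  have hs := hsymm.eq x (B x)
  rw [divergence, hfd]
  simp only [trace3_add, trace3_sub, trace3_smul, trace3_smulRight, trace3_id, hw0, hB0, id,
    add_apply, ContinuousLinearMap.comp_apply, ContinuousLinearMap.flip_apply,
    ContinuousLinearMap.id_apply]
  linarith

/-- The cut-offs `solenoidalCutoff χ(·/R) w` are bounded uniformly in `R`: the factor `1/R` of
`∇χ(·/R)` compensates the growth of the vector potential. -/
theorem exists_bound_solenoidalCutoff {χ : E3 → ℝ} (hχ : ContDiff ℝ ∞ χ)
    (hsupp : HasCompactSupport χ) {w : E3 → E3} {M : ℝ} (hM : ∀ x, ‖w x‖ ≤ M) :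
    ∃ K, ∀ (R : ℝ) (x : E3), ‖solenoidalCutoff (fun y => χ (R⁻¹ • y)) w x‖ ≤ K := by
  have hχ' : Continuous (fderiv ℝ χ) := hχ.continuous_fderiv (by simp)
  have hM0 : 0 ≤ M := (norm_nonneg _).trans (hM 0)
  obtain ⟨a, ha⟩ := hsupp.exists_bound_of_continuous hχ.continuous
  obtain ⟨b, hb⟩ := ((hsupp.fderiv ℝ).smul_left (f := fun x : E3 => ‖x‖)).exists_bound_of_continuous
    (continuous_norm.smul hχ')
  refine ⟨a * M + b * M + b * M, fun R x => ?_⟩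
  have hd : fderiv ℝ (fun y => χ (R⁻¹ • y)) x = R⁻¹ • fderiv ℝ χ (R⁻¹ • x) := by
    have h1 : HasFDerivAt (fun y : E3 => R⁻¹ • y) (R⁻¹ • ContinuousLinearMap.id ℝ E3) x :=
      (hasFDerivAt_id (𝕜 := ℝ) x).const_smul R⁻¹
    have h2 := (hχ.differentiable (by simp) (R⁻¹ • x)).hasFDerivAt.comp x h1
    rw [ContinuousLinearMap.comp_smul, ContinuousLinearMap.comp_id] at h2
    exact h2.fderiv
  have hb' : ‖fderiv ℝ (fun y => χ (R⁻¹ • y)) x‖ * ‖x‖ ≤ b := by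
    have := hb (R⁻¹ • x)
    simp only [Pi.smul_apply', norm_smul, norm_mul, norm_norm] at this
    rw [hd, norm_smul]
    linarith
  have hB := norm_poincareField_le hM x
  set L := fderiv ℝ (fun y => χ (R⁻¹ • y)) x
  have h1 : ‖χ (R⁻¹ • x) • w x‖ ≤ a * M := by
    rw [norm_smul]
    exact mul_le_mul (ha _) (hM x) (norm_nonneg _) ((norm_nonneg _).trans (ha x))
  have h2 : ‖L x • poincareField w x‖ ≤ b * M := by
    rw [norm_smul]
    exact mul_le_mul ((L.le_opNorm x).trans hb') hB (norm_nonneg _)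
      ((by positivity : 0 ≤ ‖L‖ * ‖x‖).trans hb')
  have h3 : ‖L (poincareField w x) • x‖ ≤ b * M := by
    rw [norm_smul]
    calc _ ≤ (‖L‖ * M) * ‖x‖ := by
          gcongr
          exact (L.le_opNorm _).trans (by gcongr)
      _ = (‖L‖ * ‖x‖) * M := by ring
      _ ≤ _ := by gcongr
  exact (norm_sub_le _ _).trans (add_le_add ((norm_add_le _ _).trans (add_le_add h1 h2)) h3)

/-- A bounded smooth solenoidal field is the bounded pointwise limit of smooth solenoidal fields of
compact support. -/
theorem exists_solenoidal_approx {w : E3 → E3} (hw : ContDiff ℝ ∞ w)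
    (hdiv : ∀ x, divergence w x = 0) {M : ℝ} (hM : ∀ x, ‖w x‖ ≤ M) :
    ∃ (φ : ℕ → E3 → E3) (K : ℝ), (∀ n, ContDiff ℝ ∞ (φ n) ∧ HasCompactSupport (φ n) ∧
      ∀ x, divergence (φ n) x = 0) ∧ (∀ n x, ‖φ n x‖ ≤ K) ∧
      ∀ x, Tendsto (fun n => φ n x) atTop (𝓝 (w x)) := by
  let χ : ContDiffBump (0 : E3) := ⟨1, 2, one_pos, one_lt_two⟩
  have hχ : ContDiff ℝ ∞ χ := χ.contDiff
  obtain ⟨K, hK⟩ := exists_bound_solenoidalCutoff hχ χ.hasCompactSupport hM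
  have hR : ∀ n : ℕ, ((n : ℝ) + 1)⁻¹ ≠ 0 := fun n => by positivity
  have hχR : ∀ n : ℕ, ContDiff ℝ ∞ fun y => χ (((n : ℝ) + 1)⁻¹ • y) := fun n =>
    hχ.comp (contDiff_id.const_smul _)
  refine ⟨fun n => solenoidalCutoff (fun y => χ (((n : ℝ) + 1)⁻¹ • y)) w, K, fun n =>
    ⟨contDiff_solenoidalCutoff (hχR n) hw, hasCompactSupport_solenoidalCutoff
      (χ.hasCompactSupport.comp_smul (hR n)) w, divergence_solenoidalCutoff (hχR n) hw hdiv⟩,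
    fun n x => hK _ x, fun x => tendsto_const_nhds.congr' ?_⟩
  filter_upwards [eventually_ge_atTop ⌈‖x‖⌉₊] with n hn
  -- near `x` the cut-off function is constantly `1`
  have hone : (fun y => χ (((n : ℝ) + 1)⁻¹ • y)) =ᶠ[𝓝 x] fun _ => 1 := by
    have hx : x ∈ Metric.ball (0 : E3) (n + 1) := by
      rw [mem_ball_zero_iff]
      linarith [Nat.ceil_le.1 hn]
    filter_upwards [Metric.isOpen_ball.mem_nhds hx] with y hy
    refine χ.one_of_mem_closedBall ?_
    rw [mem_ball_zero_iff] at hy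
    rw [mem_closedBall_zero_iff, norm_smul, norm_inv, Real.norm_of_nonneg (by positivity),
      inv_mul_le_iff₀ (by positivity)]
    change ‖y‖ ≤ (n + 1) * 1
    linarith
  have h1 : χ (((n : ℝ) + 1)⁻¹ • x) = 1 := hone.eq_of_nhds
  have h0 : fderiv ℝ (fun y => χ (((n : ℝ) + 1)⁻¹ • y)) x = 0 := by
    rw [hone.fderiv_eq]
    simp
  simp [solenoidalCutoff, h1, h0]

/-! ### Mollification -/

/-- The mollification `ρ ⋆ v` of a vector field by a normalized bump function. -/
def mollify (φ : ContDiffBump (0 : E3)) (v : E3 → E3) : E3 → E3 :=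
  convolution (φ.normed volume) v (ContinuousLinearMap.lsmul ℝ ℝ) volume

theorem mollify_apply (φ : ContDiffBump (0 : E3)) (v : E3 → E3) (x : E3) :
    mollify φ v x = ∫ t, φ.normed volume (x - t) • v t := by
  rw [mollify, convolution_eq_swap]
  rfl

theorem contDiff_mollify (φ : ContDiffBump (0 : E3)) {v : E3 → E3} (hv : LocallyIntegrable v) :
    ContDiff ℝ ∞ (mollify φ v) :=
  φ.hasCompactSupport_normed.contDiff_convolution_left _ φ.contDiff_normed hv

theorem norm_normed_smul_le {φ : ContDiffBump (0 : E3)} (hφ : φ.rOut ≤ 1) {K : ℝ}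
    (hK : ∀ x, ‖φ.normed volume x‖ ≤ K) (v : E3 → E3) (x t : E3) :
    ‖φ.normed volume (x - t) • v t‖ ≤ (Metric.closedBall x 3).indicator (fun t => K * ‖v t‖) t := by
  rw [norm_smul]
  by_cases ht : t ∈ Metric.closedBall x 3
  · rw [indicator_of_mem ht]
    gcongr
    exact hK _
  · have : φ.normed volume (x - t) = 0 := by
      rw [← Function.notMem_support, φ.support_normed_eq, mem_ball_zero_iff, ← dist_eq_norm,
        dist_comm]
      rw [Metric.mem_closedBall] at ht
      linarith
    rw [indicator_of_notMem ht, this, norm_zero, zero_mul]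

theorem IsUnifLocIntegrable.exists_bound_mollify {v : E3 → E3} {C : ℝ}
    (hv : IsUnifLocIntegrable v C) {φ : ContDiffBump (0 : E3)} (hφ : φ.rOut ≤ 1) :
    ∃ M, ∀ x, ‖mollify φ v x‖ ≤ M := by
  obtain ⟨K, hK⟩ := φ.hasCompactSupport_normed (μ := volume).exists_bound_of_continuous
    φ.continuous_normed
  refine ⟨K * C, fun x => ?_⟩
  have hK0 : 0 ≤ K := (norm_nonneg _).trans (hK 0)
  rw [mollify_apply]
  have hint : Integrable ((Metric.closedBall x 3).indicator fun t => K * ‖v t‖) :=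
    IntegrableOn.integrable_indicator
      ((hv.1.integrableOn_isCompact (isCompact_closedBall x 3)).norm.const_mul K)
      Metric.isClosed_closedBall.measurableSet
  refine (norm_integral_le_of_norm_le hint (.of_forall (norm_normed_smul_le hφ hK v x))).trans ?_
  rw [integral_indicator Metric.isClosed_closedBall.measurableSet, integral_const_mul]
  exact mul_le_mul_of_nonneg_left (hv.2 x) hK0

/-- Mollification turns weak into classical divergence-freeness: `div (ρ ⋆ v)(x)` is the pairing of
`v` with the gradient of the test function `-ρ(x - ·)`. -/
theorem divergence_mollify (φ : ContDiffBump (0 : E3)) {v : E3 → E3} (hv : IsWeaklyDivFree v)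
    (x : E3) : divergence (mollify φ v) x = 0 := by
  set ρ := φ.normed (volume : Measure E3)
  have hρ : ContDiff ℝ ∞ ρ := φ.contDiff_normed
  have hρs : HasCompactSupport ρ := φ.hasCompactSupport_normed
  have hd := hρs.hasFDerivAt_convolution_left (ContinuousLinearMap.lsmul ℝ ℝ : ℝ →L[ℝ] E3 →L[ℝ] E3)
    (hρ.of_le (by simp)) hv.1 x
  have hex := ((hρs.fderiv ℝ).convolutionExists_left
    ((ContinuousLinearMap.lsmul ℝ ℝ : ℝ →L[ℝ] E3 →L[ℝ] E3).precompL E3)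
    (hρ.continuous_fderiv (by simp)) hv.1 x).integrable_swap
  have hcoord : ∀ j : Fin 3, fderiv ℝ (mollify φ v) x (EuclideanSpace.single j 1) j =
      ∫ t, pd j ρ (x - t) * v t j := fun j => by
    rw [mollify, hd.fderiv, convolution_eq_swap, ContinuousLinearMap.integral_apply hex]
    have := (EuclideanSpace.proj j : E3 →L[ℝ] ℝ).integral_comp_comm
      (hex.apply_continuousLinearMap (EuclideanSpace.single j 1))
    exact this.symm
  have hint : ∀ j : Fin 3, Integrable fun t => pd j ρ (x - t) * v t j := fun j =>
    (EuclideanSpace.proj j : E3 →L[ℝ] ℝ).integrable_comp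
      (hex.apply_continuousLinearMap (EuclideanSpace.single j 1))
  have htest : IsTest fun t => ρ (x - t) :=
    ⟨hρ.comp (contDiff_const.sub contDiff_id), hρs.comp_homeomorph (Homeomorph.subLeft x)⟩
  have hpd : ∀ j t, pd j (fun t => ρ (x - t)) t = -pd j ρ (x - t) := fun j t => by
    have h1 : HasFDerivAt (fun t : E3 => x - t) (-ContinuousLinearMap.id ℝ E3) t :=
      (hasFDerivAt_id t).const_sub x
    have h2 := (hρ.differentiable (by simp) (x - t)).hasFDerivAt.comp t h1
    rw [pd, show (fun t => ρ (x - t)) = ρ ∘ fun t => x - t from rfl, h2.fderiv]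
    simp [pd]
  have h0 := hv.2 _ htest
  simp_rw [hpd] at h0
  rw [divergence, trace3, Finset.sum_congr rfl fun j _ => hcoord j,
    ← integral_finsetSum _ fun j _ => hint j, ← neg_eq_zero, ← integral_neg, ← h0]
  refine integral_congr_ae (.of_forall fun t => ?_)
  simp only [← Finset.sum_neg_distrib]
  exact Finset.sum_congr rfl fun j _ => by ring

theorem norm_mollify_Ecal_le (e : ℕ ≃ ℕ × (Fin 3 → ℚ)) (k : ℕ) {φ : ContDiffBump (0 : E3)}
    (hφ : φ.rOut ≤ 1) (y : E3) :
    ‖mollify φ (Ecal e k) y‖ ≤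
      (Metric.closedBall (centre e k) 3).indicator (fun _ => (2 : ℝ)) y := by
  rw [mollify_apply]
  by_cases hy : y ∈ Metric.closedBall (centre e k) 3
  · rw [indicator_of_mem hy]
    have hint : Integrable fun t => φ.normed volume (y - t) * 2 :=
      (φ.integrable_normed.comp_sub_left y).mul_const 2
    refine (norm_integral_le_of_norm_le hint (.of_forall fun t => ?_)).trans ?_
    · rw [norm_smul, Real.norm_of_nonneg (φ.nonneg_normed _)]
      refine mul_le_mul_of_nonneg_left ?_ (φ.nonneg_normed _)
      exact (norm_Ecal_le e k t).trans (indicator_le_self' (fun _ _ => by norm_num) t)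
    · rw [integral_mul_const, integral_sub_left_eq_self (φ.normed volume), φ.integral_normed,
        one_mul]
  · rw [indicator_of_notMem hy, integral_eq_zero_of_ae (.of_forall fun t => ?_), norm_zero]
    by_cases ht : t ∈ Metric.closedBall (centre e k) 2
    · have : φ.normed volume (y - t) = 0 := by
        rw [← Function.notMem_support, φ.support_normed_eq, mem_ball_zero_iff, ← dist_eq_norm]
        rw [Metric.mem_closedBall] at hy ht
        linarith [dist_triangle y t (centre e k)]
      simp [this]
    · have := norm_Ecal_le e k t
      rw [← centre, indicator_of_notMem ht] at this
      simp [norm_le_zero_iff.1 this]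

/-- Mollification is symmetric for the pairing with `𝓔ₖ`, a bump function being even. -/
theorem Ffun_mollify (e : ℕ ≃ ℕ × (Fin 3 → ℚ)) (k : ℕ) {φ : ContDiffBump (0 : E3)}
    (hφ : φ.rOut ≤ 1) {v : E3 → E3} (hv : LocallyIntegrable v) :
    Ffun e k (mollify φ v) = ∫ y, inner ℝ (mollify φ (Ecal e k) y) (v y) := by
  set ρ := φ.normed (volume : Measure E3)
  have hρc : Continuous ρ := φ.continuous_normed
  obtain ⟨K, hK⟩ := φ.hasCompactSupport_normed (μ := volume).exists_bound_of_continuous hρc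
  have hK0 : 0 ≤ K := (norm_nonneg _).trans (hK 0)
  have hE := integrable_Ecal e k
  have hvx : ∀ x, Integrable fun t => ρ (x - t) • v t := fun x =>
    (φ.hasCompactSupport_normed.convolutionExists_left (ContinuousLinearMap.lsmul ℝ ℝ)
      hρc hv x).integrable_swap
  have hEx : ∀ y, Integrable fun x => ρ (y - x) • Ecal e k x := fun y =>
    (φ.hasCompactSupport_normed.convolutionExists_left (ContinuousLinearMap.lsmul ℝ ℝ)
      hρc hE.locallyIntegrable y).integrable_swap
  set S := Metric.closedBall (centre e k) 3
  have hvS : Integrable (S.indicator v) :=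
    IntegrableOn.integrable_indicator (hv.integrableOn_isCompact (isCompact_closedBall _ _))
      Metric.isClosed_closedBall.measurableSet
  have hprod : Integrable (Function.uncurry fun x y : E3 =>
      (inner ℝ (Ecal e k x) (ρ (x - y) • v y) : ℝ)) (volume.prod volume) := by
    refine ((hE.norm.mul_prod hvS.norm).const_mul K).mono' ?_ (.of_forall fun q => ?_)
    · have h1 : AEStronglyMeasurable (fun q : E3 × E3 => Ecal e k q.1) (volume.prod volume) :=
        hE.aestronglyMeasurable.comp_fst
      have h2 : AEStronglyMeasurable (fun q : E3 × E3 => v q.2) (volume.prod volume) :=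
        hv.aestronglyMeasurable.comp_snd
      have h3 : Continuous fun q : E3 × E3 => ρ (q.1 - q.2) := by fun_prop
      exact h1.inner (h3.aestronglyMeasurable.smul h2)
    · obtain ⟨x, y⟩ := q
      simp only [Function.uncurry_apply_pair]
      by_cases hy : y ∈ S
      · rw [indicator_of_mem hy]
        refine (norm_inner_le_norm _ _).trans ?_
        rw [norm_smul, mul_left_comm]
        gcongr
        exact hK _
      · have : (inner ℝ (Ecal e k x) (ρ (x - y) • v y) : ℝ) = 0 := by
          by_cases hx : x ∈ Metric.closedBall (centre e k) 2
          · have : ρ (x - y) = 0 := by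
              rw [← Function.notMem_support, φ.support_normed_eq, mem_ball_zero_iff,
                ← dist_eq_norm]
              rw [Metric.mem_closedBall] at hx hy
              have := dist_triangle y x (centre e k)
              rw [dist_comm y x] at this
              linarith
            simp [this]
          · have := norm_Ecal_le e k x
            rw [← centre, indicator_of_notMem hx] at this
            simp [norm_le_zero_iff.1 this]
        rw [this, norm_zero]
        positivity
  calc Ffun e k (mollify φ v)
      = ∫ x, ∫ y, (inner ℝ (Ecal e k x) (ρ (x - y) • v y) : ℝ) :=
        integral_congr_ae (.of_forall fun x => by
          simp only [mollify_apply]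
          exact (integral_inner (hvx x) _).symm)
    _ = ∫ y, ∫ x, (inner ℝ (Ecal e k x) (ρ (x - y) • v y) : ℝ) := integral_integral_swap hprod
    _ = ∫ y, inner ℝ (mollify φ (Ecal e k) y) (v y) :=
        integral_congr_ae (.of_forall fun y => by
          simp only [mollify_apply]
          rw [real_inner_comm, ← integral_inner (hEx y)]
          refine integral_congr_ae (.of_forall fun x => ?_)
          simp only [real_inner_smul_right]
          rw [real_inner_comm, show x - y = -(y - x) by abel,
            show ρ (-(y - x)) = ρ (y - x) from φ.normed_neg _])

theorem IsUnifLocIntegrable.abs_Ffun_mollify_le {v : E3 → E3} {C : ℝ}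
    (hv : IsUnifLocIntegrable v C) (e : ℕ ≃ ℕ × (Fin 3 → ℚ)) (k : ℕ) {φ : ContDiffBump (0 : E3)}
    (hφ : φ.rOut ≤ 1) : |Ffun e k (mollify φ v)| ≤ 2 * C := by
  rw [Ffun_mollify e k hφ hv.1]
  exact hv.abs_integral_inner_le (norm_mollify_Ecal_le e k hφ)

/-- The standard mollifiers, with supports of radius `1 / (n + 1)`. -/
def stdBump (n : ℕ) : ContDiffBump (0 : E3) where
  rIn := 1 / (n + 1) / 2
  rOut := 1 / (n + 1)
  rIn_pos := by positivity
  rIn_lt_rOut := half_lt_self (by positivity)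

theorem stdBump_rOut_le (n : ℕ) : (stdBump n).rOut ≤ 1 := by
  change 1 / ((n : ℝ) + 1) ≤ 1
  rw [div_le_one (by positivity)]
  linarith [(Nat.cast_nonneg n : (0 : ℝ) ≤ n)]

theorem tendsto_Ffun_mollify (e : ℕ ≃ ℕ × (Fin 3 → ℚ)) (k : ℕ) {v : E3 → E3}
    (hv : LocallyIntegrable v) :
    Tendsto (fun n => Ffun e k (mollify (stdBump n) v)) atTop (𝓝 (Ffun e k v)) := by
  simp_rw [Ffun_mollify e k (stdBump_rOut_le _) hv]
  refine tendsto_integral_of_dominated_convergence _ (fun n => ?_)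
    (integrable_indicator_norm hv (centre e k) 3)
    (fun n => .of_forall (norm_inner_le_indicator
      (norm_mollify_Ecal_le e k (stdBump_rOut_le n)))) ?_
  · have := contDiff_mollify (stdBump n) (integrable_Ecal e k).locallyIntegrable
    exact this.continuous.aestronglyMeasurable.inner hv.aestronglyMeasurable
  · filter_upwards [ContDiffBump.ae_convolution_tendsto_right_of_locallyIntegrable (φ := stdBump)
      (l := atTop) (K := 2) (μ := volume) tendsto_one_div_add_atTop_nhds_zero_nat
      (.of_forall fun n => by
        change 1 / ((n : ℝ) + 1) ≤ 2 * (1 / (n + 1) / 2)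
        linarith)
      (integrable_Ecal e k).locallyIntegrable] with y hy
    exact hy.inner tendsto_const_nhds

/-! ### Solenoidal fields lie in `ℍ_sd` -/

theorem isUnifLocIntegrable_of_bounded {w : E3 → E3} (hw : Continuous w) {M : ℝ}
    (hM : ∀ x, ‖w x‖ ≤ M) :
    IsUnifLocIntegrable w (M * (volume (Metric.closedBall (0 : E3) 3)).toReal) := by
  refine ⟨hw.locallyIntegrable, fun c => ?_⟩
  have := setIntegral_mono_on (μ := volume) (s := Metric.closedBall c 3) (f := fun x => ‖w x‖)
    (g := fun _ => M) (hw.norm.locallyIntegrable.integrableOn_isCompact (isCompact_closedBall c 3))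
    (integrableOn_const measure_closedBall_lt_top.ne) Metric.isClosed_closedBall.measurableSet
    fun x _ => hM x
  rwa [setIntegral_const, smul_eq_mul, mul_comm, Measure.real,
    Measure.addHaar_closedBall_center] at this

theorem mem_Hsd_of_bounded_smooth {e : ℕ ≃ ℕ × (Fin 3 → ℚ)} {w : E3 → E3} (hw : ContDiff ℝ ∞ w)
    (hdiv : ∀ x, divergence w x = 0) {M : ℝ} (hM : ∀ x, ‖w x‖ ≤ M) {V : SD2 e}
    (hV : RepresentsSD e w V) : V ∈ Hsd e := by
  obtain ⟨φ, K, hφ, hK, hlim⟩ := exists_solenoidal_approx hw hdiv hM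
  have hmem : ∀ n, MemLp (φ n) 2 volume := fun n =>
    (hφ n).1.continuous.memLp_of_hasCompactSupport (hφ n).2.1
  have hF : ∀ n k, FSD e k (ofL2 e ((hmem n).toLp _)) = Ffun e k (φ n) := fun n k => by
    rw [FSD_ofL2]
    refine integral_congr_ae ?_
    filter_upwards [(hmem n).coeFn_toLp] with x hx
    rw [hx]
  have hbd : ∀ n k, |Ffun e k (φ n)| ≤ 2 * _ := fun n k =>
    (isUnifLocIntegrable_of_bounded (hφ n).1.continuous (hK n)).abs_Ffun_le e k
  have hbw : ∀ k, |Ffun e k w| ≤ 2 * _ := fun k =>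
    (isUnifLocIntegrable_of_bounded hw.continuous hM).abs_Ffun_le e k
  set c := (volume (Metric.closedBall (0 : E3) 3)).toReal
  have htend : Tendsto (fun n => ofL2 e ((hmem n).toLp _)) atTop (𝓝 V) := by
    refine tendsto_SD2_of_coord (C := 2 * (K * c) + 2 * (M * c)) e (.of_forall fun n k => ?_)
      fun k => ?_
    · rw [hF, hV.2 k]
      exact (abs_sub _ _).trans (add_le_add (hbd n k) (hbw k))
    · simp_rw [hF, hV.2 k]
      refine tendsto_integral_of_dominated_convergence (fun x => ‖Ecal e k x‖ * K) (fun n => ?_)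
        ((integrable_Ecal e k).norm.mul_const K) (fun n => .of_forall fun x => ?_)
        (.of_forall fun x => tendsto_const_nhds.inner (hlim x))
      · exact (measurable_Ecal e k).aestronglyMeasurable.inner
          (hφ n).1.continuous.aestronglyMeasurable
      · exact (norm_inner_le_norm _ _).trans
          (mul_le_mul_of_nonneg_left (hK n x) (norm_nonneg _))
  refine isClosed_closure.mem_of_tendsto htend (.of_forall fun n => subset_closure ?_)
  refine ⟨φ n, (hφ n).1, (hφ n).2.1, fun x => ?_, _, (hmem n).coeFn_toLp, rfl⟩
  rw [sum_pd_eq_divergence ((hφ n).1.differentiable (by simp) x), (hφ n).2.2]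

/-- Weakly divergence-free, uniformly locally integrable fields lie in `ℍ_sd`: they are limits in
`SD²` of their mollifications, which are bounded, smooth and solenoidal. -/
theorem IsUnifLocIntegrable.mem_Hsd {e : ℕ ≃ ℕ × (Fin 3 → ℚ)} {v : E3 → E3} {C : ℝ}
    (hv : IsUnifLocIntegrable v C) (hdiv : IsWeaklyDivFree v) {V : SD2 e}
    (hV : RepresentsSD e v V) : V ∈ Hsd e := by
  have hmoll : ∀ n, ∃ W : SD2 e, RepresentsSD e (mollify (stdBump n) v) W ∧ W ∈ Hsd e := by
    intro n
    have hsm := contDiff_mollify (stdBump n) hv.1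
    obtain ⟨M, hM⟩ := hv.exists_bound_mollify (stdBump_rOut_le n)
    obtain ⟨W, hW⟩ := (isUnifLocIntegrable_of_bounded hsm.continuous hM).exists_representsSD e
    exact ⟨W, hW, mem_Hsd_of_bounded_smooth hsm (divergence_mollify _ hdiv) hM hW⟩
  choose W hW hWH using hmoll
  refine isClosed_closure.mem_of_tendsto (tendsto_SD2_of_coord (l := atTop) (V := W)
    (C := 2 * C + 2 * C) e (.of_forall fun n k => ?_) fun k => ?_) (.of_forall hWH)
  · rw [(hW n).2, hV.2]
    exact (abs_sub _ _).trans
      (add_le_add (hv.abs_Ffun_mollify_le e k (stdBump_rOut_le n)) (hv.abs_Ffun_le e k))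
  · simp_rw [(hW _).2, hV.2]
    exact tendsto_Ffun_mollify e k hv.1

/-! ### Transfer of solutions along `L^p → SD²` -/

section Transfer

variable {X Y : Type*} [NormedAddCommGroup X] [NormedSpace ℝ X] [NormedAddCommGroup Y]
  [NormedSpace ℝ Y]

/-- `J` maps each field in `X` to the same field in `Y`, and the solenoidal part of `X` into that
of `Y`. -/
structure IsFieldMap (R : FieldSpace X) (S : FieldSpace Y) (J : X →L[ℝ] Y) : Prop where
  isField : ∀ {v V}, R.IsField v V → S.IsField v (J V)
  solenoidal : ∀ {V}, V ∈ R.solenoidal → J V ∈ S.solenoidal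

variable {R : FieldSpace X} {S : FieldSpace Y} {J : X →L[ℝ] Y} {ν : ℝ} {T : EReal}
  {u₀ : E3 → E3} {u : ℝ → E3 → E3}

theorem IsFieldMap.isFlowIn (hJ : IsFieldMap R S J) {U : ℝ → X} (h : IsFlowIn R T u₀ u U) :
    IsFlowIn S T u₀ u (J ∘ U) :=
  ⟨h.1, J.continuous.comp_continuousOn h.2.1, fun t ht =>
    ⟨(h.2.2 t ht).1, hJ.isField (h.2.2 t ht).2.1, hJ.solenoidal (h.2.2 t ht).2.2⟩⟩

theorem IsFieldMap.isStrongSolution (hJ : IsFieldMap R S J) (h : IsStrongSolution R ν T u₀ u) :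
    IsStrongSolution S ν T u₀ u := by
  obtain ⟨U, A, B, hU, hc, hsol⟩ := h
  have hlin : (fun t => ν • J (A t) - J (B t)) = fun t => J (ν • A t - B t) := by
    ext1 t
    rw [map_sub, map_smul]
  refine ⟨J ∘ U, J ∘ A, J ∘ B, hJ.isFlowIn hU, ?_, fun t ht => ?_⟩
  · simp only [Function.comp, hlin]
    exact J.continuous.comp_continuousOn hc
  · obtain ⟨hd, ⟨w, hw, hwA⟩, D, g, hD, hg, hgB⟩ := hsol t ht
    refine ⟨?_, ⟨w, hw, hJ.isField hwA⟩, D, g, hD, hg, hJ.isField hgB⟩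
    simp only [Function.comp, congrFun hlin t]
    exact J.hasFDerivAt.comp_hasDerivAt t hd

theorem IsFieldMap.isMildSolution [CompleteSpace X] [CompleteSpace Y] (hJ : IsFieldMap R S J)
    (h : IsMildSolution R ν T u₀ u) : IsMildSolution S ν T u₀ u := by
  obtain ⟨U, hU, hsol⟩ := h
  refine ⟨J ∘ U, hJ.isFlowIn hU, fun t ht => ?_⟩
  obtain ⟨H, N, ⟨w, hw, hwH⟩, hN, hint, hUt⟩ := hsol t ht
  refine ⟨J H, J ∘ N, ⟨w, hw, hJ.isField hwH⟩, ?_, ?_, ?_⟩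
  · filter_upwards [hN] with s hs
    obtain ⟨w, hw, hwN⟩ := hs
    exact ⟨w, hw, hJ.isField hwN⟩
  · exact ⟨J.integrable_comp hint.1, J.integrable_comp hint.2⟩
  · rw [Function.comp, hUt, map_sub, ← J.intervalIntegral_comp_comm hint]
    rfl

end Transfer

/-- Every space continuously embedded in `L^p` maps to `SD²` so that fields and solenoidality are
preserved. -/
theorem exists_isFieldMap (e : ℕ ≃ ℕ × (Fin 3 → ℚ)) {p : ℝ≥0∞} [Fact (1 ≤ p)] {𝓑 : Type*}
    [NormedAddCommGroup 𝓑] [NormedSpace ℝ 𝓑]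
    (ι : 𝓑 →L[ℝ] Lp E3 p (volume : Measure E3)) :
    ∃ J : 𝓑 →L[ℝ] SD2 e, IsFieldMap (lpFields ι) (sdFields e) J := by
  obtain ⟨J, hJ⟩ := exists_Lp_to_SD2 e p
  exact ⟨J.comp ι, fun h => (hJ (ι _)).congr_ae h,
    fun h => (isUnifLocIntegrable_Lp Fact.out (ι _)).mem_Hsd h (hJ (ι _))⟩

end NavierStokesSD

end

theorem theorem5 (e : ℕ ≃ ℕ × (Fin 3 → ℚ)) (p : ℝ≥0∞) [Fact (1 ≤ p)]
    (ν : ℝ) (hν : 0 < ν) (T : EReal) (hT : 0 < T)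
    (u₀ : NavierStokesSD.E3 → NavierStokesSD.E3)
    (u : ℝ → NavierStokesSD.E3 → NavierStokesSD.E3)
    (𝓑 : Type*) [NormedAddCommGroup 𝓑] [NormedSpace ℝ 𝓑] [CompleteSpace 𝓑]
    (ι : 𝓑 →L[ℝ] Lp NavierStokesSD.E3 p (volume : Measure NavierStokesSD.E3))
    (hι : Function.Injective ι) :
    -- Kato solutions in `L^p`, in the strong and in the mild form
    (NavierStokesSD.IsStrongSolution (NavierStokesSD.lpFields
          (ContinuousLinearMap.id ℝ (Lp NavierStokesSD.E3 p (volume : Measure NavierStokesSD.E3))))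
          ν T u₀ u →
        NavierStokesSD.IsStrongSolution (NavierStokesSD.sdFields e) ν T u₀ u) ∧
    (NavierStokesSD.IsMildSolution (NavierStokesSD.lpFields
          (ContinuousLinearMap.id ℝ (Lp NavierStokesSD.E3 p (volume : Measure NavierStokesSD.E3))))
          ν T u₀ u →
        NavierStokesSD.IsMildSolution (NavierStokesSD.sdFields e) ν T u₀ u) ∧
    -- Kato solutions in the space `𝓑` continuously embedded in `L^p`
    (NavierStokesSD.IsStrongSolution (NavierStokesSD.lpFields ι) ν T u₀ u →
        NavierStokesSD.IsStrongSolution (NavierStokesSD.sdFields e) ν T u₀ u) ∧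
    (NavierStokesSD.IsMildSolution (NavierStokesSD.lpFields ι) ν T u₀ u →
        NavierStokesSD.IsMildSolution (NavierStokesSD.sdFields e) ν T u₀ u) := by
  obtain ⟨J, hJ⟩ := NavierStokesSD.exists_isFieldMap e
    (ContinuousLinearMap.id ℝ (Lp NavierStokesSD.E3 p (volume : Measure NavierStokesSD.E3)))
  obtain ⟨J', hJ'⟩ := NavierStokesSD.exists_isFieldMap e ι
  exact ⟨hJ.isStrongSolution, hJ.isMildSolution, hJ'.isStrongSolution, hJ'.isMildSolution⟩
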